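/- Let $X$ be a compact complex manifold of dimension $n$ and let $D\subset X$ be a non-empty divisor with simple normal crossings, with distinct smooth irreducible components $D_1,\dots,D_m$ ($m\ge 1$). For each $k$ let $s_k$ be a global section of the holomorphic line bundle $\mathcal O(D_k)$ with $\operatorname{div}s_k=D_k$, and let $\|\cdot\|_k$ be a smooth hermitian metric on $\mathcal O(D_k)$ with $\|s_k\|_k^2\le e^{-e}$ on $X$. For an integer $N\ge 0$ put $$\Theta_N=\sum_{k=1}^m\bigl(\log\log\|s_k\|_k^{-2}\bigr)^N\quad\text{on }X\setminus D,$$ and let $dd^c=\frac{i}{2\pi}\partial\bar\partial$. A holomorphic chart $(V;z_1,\dots,z_n)$ is adapted to $D$ if $|z_i|<1/e$ on $V$ for all $i$ and $D\cap V=\{z_1\cdots z_r=0\}$ for some $0\le r\le n$; in such a chart put $d\zeta_k=\dfrac{dz_k}{z_k\log|z_k|^{-1}}$ for $k\le r$ and $d\zeta_k=dz_k$ for $k>r$. A real $(1,1)$-form $\eta$ on $X\setminus D$ has log-log growth along $D$ if in every adapted chart $\eta=\sum_{j,k}\alpha_{jk}\,d\zeta_j\wedge d\bar\zeta_k$ on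 $V\setminus D$ with $\alpha_{jk}\in C^\infty(V\setminus D,\mathbb C)$ such that for every open $V'$ relatively compact in $V$ there are $C$ and an integer $M\ge0$ with $|\alpha_{jk}|\le C\prod_{i=1}^r(\log\log|z_i|^{-1})^M$ on $V'\setminus D$. It has Poincaré growth along $D$ if the same holds with the $\alpha_{jk}$ locally bounded on $V$ (that is, bounded on each $V'\setminus D$). Let $\omega$ be a smooth positive $(1,1)$-form on $X$ (positive definite at every point), and let $\eta$ be a real $(1,1)$-form on $X\setminus D$ with log-log growth along $D$. Then there are constants $A,B>0$ and an integer $N\ge 0$ such that $$\eta+B\,\Theta_N\bigl(dd^c(-\Theta_1)+A\,\omega\bigr)\ge 0\quad\text{on }X\setminus D.$$ If moreover $\eta$ has Poincaré growth along $D$, then such constants $A,B>0$ exist with $N=0$. -/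

import Mathlib

open Set Bundle
open scoped Manifold ContDiff ComplexConjugate

noncomputable section

namespace LogLogForms

/-! ### Real 2-forms and the operator `dd^c`, on a manifold modelled on a complex vector space -/

section Forms

variable {E : Type*} [NormedAddCommGroup E] [NormedSpace ℂ E]
  {X : Type*} [TopologicalSpace X] [ChartedSpace E X]

variable (E X) in
/-- A field of real-valued alternating real-bilinear forms on the tangent spaces of the complex
manifold `X` (a real 2-form; no smoothness is required here). -/
abbrev RealTwoForm : Type _ :=
  ∀ x : X, TangentSpace 𝓘(ℂ, E) x [⋀^Fin 2]→L[ℝ] ℝ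

/-- `f` is a `C^∞` function, in the real sense, on the subset `U` of the complex manifold `X`. -/
def SmoothOn {F : Type*} [NormedAddCommGroup F] [NormedSpace ℝ F] (f : X → F) (U : Set X) : Prop :=
  ContMDiffOn 𝓘(ℝ, E) 𝓘(ℝ, F) ∞ f U

/-- Multiplication by `i` on a complex vector space, as a real-linear map. -/
def mulI : E →L[ℝ] E := (Complex.I • ContinuousLinearMap.id ℂ E).restrictScalars ℝ

/-- The 1-form `d^c g = (i / 4π) (∂̄ g - ∂ g)` of a real function `g` on a complex vector space;
as a real form it is `v ↦ - (1 / 4π) dg (i v)`. -/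
def dc (g : E → ℝ) (z : E) : E [⋀^Fin 1]→L[ℝ] ℝ :=
  (-(4 * Real.pi)⁻¹) •
    ContinuousAlternatingMap.ofSubsingleton ℝ E ℝ (0 : Fin 1) ((fderiv ℝ g z).comp mulI)

/-- The real (1,1)-form `dd^c f = d (d^c f) = (i / 2π) ∂ ∂̄ f` of a real function `f` on `X`.  It is
computed at `x` in the preferred holomorphic chart at `x`, through which Mathlib
identifies the tangent space at `x` with the model space `E`. -/
def ddc (f : X → ℝ) : RealTwoForm E X := fun x =>
  (extDeriv (dc (f ∘ (chartAt E x).symm)) (chartAt E x x) : E [⋀^Fin 2]→L[ℝ] ℝ)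

/-- The value at the pair `(v, w)` of the 2-form `a ∧ b̄`. -/
def wedgeConj {T : Type*} (a b : T → ℂ) (v w : T) : ℂ :=
  a v * conj (b w) - a w * conj (b v)

/-- Semipositivity at `x` of a real (1,1)-form `θ`: `θ (v, i v) ≥ 0` for every tangent vector `v`.
For `θ = (i / 2π) ∑ h_jk dz_j ∧ dz̄_k` it says that the matrix `(h_jk)` is positive semidefinite. -/
def NonnegAt (θ : RealTwoForm E X) (x : X) : Prop :=
  ∀ v : TangentSpace 𝓘(ℂ, E) x, 0 ≤ θ x ![v, Complex.I • v]

end Forms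

/-! ### Normal crossings divisors, adapted charts, growth conditions -/

section Growth

variable {n : ℕ} {X : Type*} [TopologicalSpace X] [ChartedSpace (Fin n → ℂ) X]

/-- `φ` is a holomorphic chart of the complex manifold `X`. -/
def IsHolChart (φ : OpenPartialHomeomorph X (Fin n → ℂ)) : Prop :=
  φ ∈ IsManifold.maximalAtlas 𝓘(ℂ, Fin n → ℂ) ω X

/-- On the domain of the chart `φ`, with coordinates `z_0, …, z_{n-1}`, the subset `D` is given by
the equation `∏_{i < m} z_i = 0`. -/
def IsCoordCrossing (D : Set X) (φ : OpenPartialHomeomorph X (Fin n → ℂ)) (m : ℕ) : Prop :=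
  m ≤ n ∧ ∀ x ∈ φ.source, (x ∈ D ↔ ∃ i : Fin n, i.val < m ∧ φ x i = 0)

/-- `D` is (the support of) a divisor with normal crossings. -/
def IsNormalCrossings (D : Set X) : Prop :=
  ∀ x : X, ∃ φ : OpenPartialHomeomorph X (Fin n → ℂ), ∃ m : ℕ,
    IsHolChart φ ∧ x ∈ φ.source ∧ IsCoordCrossing D φ m

/-- `Z` is a smooth analytic hypersurface of `X`. -/
def IsSmoothHypersurface (Z : Set X) : Prop :=
  IsClosed Z ∧ ∀ x ∈ Z, ∃ φ : OpenPartialHomeomorph X (Fin n → ℂ), ∃ i : Fin n,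
    IsHolChart φ ∧ x ∈ φ.source ∧ ∀ y ∈ φ.source, (y ∈ Z ↔ φ y i = 0)

/-- `⋃ k, D k` is a divisor with simple normal crossings and the `D k` are its (pairwise distinct)
smooth irreducible components.  A smooth hypersurface is irreducible exactly when it is
connected (and non-empty). -/
structure IsSNC {ι : Type*} (D : ι → Set X) : Prop where
  normalCrossings : IsNormalCrossings (n := n) (⋃ k, D k)
  smooth : ∀ k, IsSmoothHypersurface (n := n) (D k)
  irreducible : ∀ k, IsConnected (D k)
  distinct : Function.Injective D

/-- `φ` is a holomorphic chart adapted to `D`: its coordinates satisfy `|z_i| < 1/e`, and `D` is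
given in it by `∏_{i < m} z_i = 0`. -/
structure IsAdapted (D : Set X) (φ : OpenPartialHomeomorph X (Fin n → ℂ)) (m : ℕ) : Prop where
  holomorphic : IsHolChart φ
  small : ∀ x ∈ φ.source, ∀ i, ‖φ x i‖ < (Real.exp 1)⁻¹
  crossing : IsCoordCrossing D φ m

/-- The coordinate 1-form `dz_k` of the chart `φ` at `x`. -/
def dz (φ : OpenPartialHomeomorph X (Fin n → ℂ)) (k : Fin n) (x : X)
    (v : TangentSpace 𝓘(ℂ, Fin n → ℂ) x) : ℂ :=
  mfderiv 𝓘(ℂ, Fin n → ℂ) 𝓘(ℂ, ℂ) (fun y => φ y k) x v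

/-- The 1-form `dζ_k`: it is `dz_k / (z_k log |z_k|⁻¹)` for `k < m` and `dz_k` for `k ≥ m`. -/
def dzeta (φ : OpenPartialHomeomorph X (Fin n → ℂ)) (m : ℕ) (k : Fin n) (x : X)
    (v : TangentSpace 𝓘(ℂ, Fin n → ℂ) x) : ℂ :=
  if k.val < m then dz φ k x v / (φ x k * (Real.log ‖φ x k‖⁻¹ : ℂ)) else dz φ k x v

/-- The smooth function `f` on `φ.source \ D` has log-log growth along `D`, in the chart `φ` in which
`D` is `∏_{i < m} z_i = 0`: on every relatively compact open subset `V'` of the chart domain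
it is bounded by a multiple of some power of `∏_{i < m} log log |z_i|⁻¹`. -/
def LogLogGrowthFun (D : Set X) (φ : OpenPartialHomeomorph X (Fin n → ℂ)) (m : ℕ)
    (f : X → ℂ) : Prop :=
  SmoothOn (E := Fin n → ℂ) f (φ.source \ D) ∧
  ∀ V' : Set X, IsOpen V' → IsCompact (closure V') → closure V' ⊆ φ.source →
    ∃ (N : ℕ) (C : ℝ), ∀ x ∈ V' \ D,
      ‖f x‖ ≤ C * ∏ i : Fin n with i.val < m, Real.log (Real.log ‖φ x i‖⁻¹) ^ N

/-- `f` is smooth on `φ.source \ D` and locally bounded on `φ.source`. -/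
def LocBoundedFun (D : Set X) (φ : OpenPartialHomeomorph X (Fin n → ℂ)) (f : X → ℂ) : Prop :=
  SmoothOn (E := Fin n → ℂ) f (φ.source \ D) ∧
  ∀ V' : Set X, IsOpen V' → IsCompact (closure V') → closure V' ⊆ φ.source →
    ∃ C : ℝ, ∀ x ∈ V' \ D, ‖f x‖ ≤ C

/-- The real 2-form `η` on `X \ D` is a (1,1)-form with log-log growth along `D`: in every chart
adapted to `D` it is `∑ α_jk dζ_j ∧ dζ̄_k`, the `α_jk` being functions with log-log growth.
The values of `η` at the points of `D` play no role. -/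
def IsLogLogGrowthOneOne (D : Set X) (η : RealTwoForm (Fin n → ℂ) X) : Prop :=
  ∀ (φ : OpenPartialHomeomorph X (Fin n → ℂ)) (m : ℕ), IsAdapted D φ m →
    ∃ α : Fin n → Fin n → X → ℂ, (∀ j k, LogLogGrowthFun D φ m (α j k)) ∧
      ∀ x ∈ φ.source \ D, ∀ v w : TangentSpace 𝓘(ℂ, Fin n → ℂ) x,
        (η x ![v, w] : ℂ) =
          ∑ j, ∑ k, α j k x * wedgeConj (dzeta φ m j x) (dzeta φ m k x) v w

/-- The real 2-form `η` on `X \ D` is a (1,1)-form with Poincaré growth along `D`: in every chart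
adapted to `D` it is `∑ α_jk dζ_j ∧ dζ̄_k`, the `α_jk` being smooth off `D` and locally bounded.
The values of `η` at the points of `D` play no role. -/
def IsPoincareGrowthOneOne (D : Set X) (η : RealTwoForm (Fin n → ℂ) X) : Prop :=
  ∀ (φ : OpenPartialHomeomorph X (Fin n → ℂ)) (m : ℕ), IsAdapted D φ m →
    ∃ α : Fin n → Fin n → X → ℂ, (∀ j k, LocBoundedFun D φ (α j k)) ∧
      ∀ x ∈ φ.source \ D, ∀ v w : TangentSpace 𝓘(ℂ, Fin n → ℂ) x,
        (η x ![v, w] : ℂ) =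
          ∑ j, ∑ k, α j k x * wedgeConj (dzeta φ m j x) (dzeta φ m k x) v w

/-- `θ` is a smooth positive (1,1)-form on `X`: in every holomorphic chart it is
`∑ g_jk dz_j ∧ dz̄_k` with smooth `g_jk`, and `θ (v, i v) > 0` for every tangent vector `v ≠ 0`. -/
structure IsSmoothPositiveOneOne (θ : RealTwoForm (Fin n → ℂ) X) : Prop where
  smooth : ∀ φ : OpenPartialHomeomorph X (Fin n → ℂ), IsHolChart φ →
    ∃ g : Fin n → Fin n → X → ℂ, (∀ j k, SmoothOn (E := Fin n → ℂ) (g j k) φ.source) ∧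
      ∀ x ∈ φ.source, ∀ v w : TangentSpace 𝓘(ℂ, Fin n → ℂ) x,
        (θ x ![v, w] : ℂ) = ∑ j, ∑ k, g j k x * wedgeConj (dz φ j x) (dz φ k x) v w
  positive : ∀ x, ∀ v : TangentSpace 𝓘(ℂ, Fin n → ℂ) x, v ≠ 0 → 0 < θ x ![v, Complex.I • v]

end Growth

/-! ### Holomorphic line bundles, divisors of sections, hermitian metrics -/

section LineBundles

variable {E : Type*} [NormedAddCommGroup E] [NormedSpace ℂ E]
  {X : Type*} [TopologicalSpace X] [ChartedSpace E X]
  (L : X → Type*) [TopologicalSpace (TotalSpace ℂ L)] [∀ x, AddCommGroup (L x)]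
  [∀ x, Module ℂ (L x)] [∀ x, TopologicalSpace (L x)] [FiberBundle ℂ L]

/-- `s` is a holomorphic section of the holomorphic line bundle `L`. -/
def IsHolSection (s : ∀ x, L x) : Prop :=
  ContMDiff 𝓘(ℂ, E) (𝓘(ℂ, E).prod 𝓘(ℂ, ℂ)) ω (fun x => (⟨x, s x⟩ : TotalSpace ℂ L))

/-- `s` is a holomorphic section of `L` and `div s = Z`, for a smooth hypersurface `Z`: `s` vanishes
exactly on `Z`, and with multiplicity one at every point of `Z`, that is, the derivative of its
expression in a trivialization of `L` is not zero there.  The pair `(L, s)` is then isomorphic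
to `O(Z)` with a section of divisor `Z`. -/
structure HasDivisor (s : ∀ x, L x) (Z : Set X) : Prop where
  holomorphic : IsHolSection (E := E) L s
  zero_iff : ∀ x, s x = 0 ↔ x ∈ Z
  simple : ∀ x ∈ Z,
    mfderiv 𝓘(ℂ, E) 𝓘(ℂ, ℂ)
      (fun y => (trivializationAt ℂ L x (⟨y, s y⟩ : TotalSpace ℂ L)).2) x ≠ 0

variable (E) in
/-- A smooth hermitian metric on the line bundle `L`, given by its norm `‖·‖`.  Smoothness: for the
local holomorphic frame `u` of `L` defined by a trivialization, `‖u‖²` is a `C^∞` function. -/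
structure HermitianMetric where
  /-- the norm on the fibres -/
  norm : ∀ x, L x → ℝ
  norm_smul : ∀ x (c : ℂ) (v : L x), norm x (c • v) = ‖c‖ * norm x v
  norm_pos : ∀ x (v : L x), v ≠ 0 → 0 < norm x v
  smooth : ∀ (e : Trivialization ℂ (TotalSpace.proj : TotalSpace ℂ L → X))
    [MemTrivializationAtlas e], SmoothOn (E := E) (fun x => norm x (e.symm x 1) ^ 2) e.baseSet

end LineBundles

section Theta

variable {E : Type*} [NormedAddCommGroup E] [NormedSpace ℂ E]
  {X : Type*} [TopologicalSpace X] [ChartedSpace E X] {ι : Type*} [Fintype ι]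
  {L : ι → X → Type*} [∀ k, TopologicalSpace (TotalSpace ℂ (L k))]
  [∀ k x, AddCommGroup (L k x)] [∀ k x, Module ℂ (L k x)] [∀ k x, TopologicalSpace (L k x)]
  [∀ k, FiberBundle ℂ (L k)]

/-- The function `Θ_N = ∑_k (log log ‖s_k‖_k⁻²)^N`. -/
def Theta (h : ∀ k, HermitianMetric E (L k)) (s : ∀ k x, L k x) (N : ℕ) (x : X) : ℝ :=
  ∑ k, Real.log (Real.log ((h k).norm x (s k x) ^ 2)⁻¹) ^ N

/-- The form `η + B Θ_N (dd^c (- Θ_1) + A θ)`. -/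
def boundForm (h : ∀ k, HermitianMetric E (L k)) (s : ∀ k x, L k x) (θ η : RealTwoForm E X)
    (A B : ℝ) (N : ℕ) : RealTwoForm E X := fun x =>
  η x + (B * Theta h s N x) • (ddc (fun y => - Theta h s 1 y) x + A • θ x)

end Theta

end LogLogForms

end

/-! Near a point of $X$ write $s_k=F_k\cdot$(frame), so that
$U_k=\log\|s_k\|_k^{-2}=-2\log|F_k|-r_k$ with $r_k$ smooth. Since $\log|F_k|$ is pluriharmonic off
$D$, the Levi form of $-\log U_k$ is $|dU_k|^2/U_k^2$ plus a bounded error, hence at least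
$2|dF_k/F_k|^2/U_k^2-C|w|^2$ (`levi_neg_log_logInvSq_lower`).

In an adapted chart each hyperplane $z_i=0$ of $D$ lies, near a point of it, in the zero set of a
single $F_k$. The zeros of $F_k$ being simple, $dF_k/F_k-dz_i/z_i$ is bounded and $U_k$ is
comparable to $\log|z_i|^{-1}$ (`coord_estimates`, `zeta_bound_of_vanishes`). So
$dd^c(-\Theta_1)+A\omega$ dominates a multiple of the Poincaré metric $\sum|d\zeta_i|^2$
(`local_poincare_bound`, `ddc_Theta_lower_bound`).

By Cauchy-Schwarz, $|\eta(v,iv)|$ is at most a multiple of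
$\max|\alpha_{jk}|\cdot\sum|d\zeta_i(v)|^2$. Each $\log\log|z_i|^{-1}$ is at most a multiple of
$\Theta_1$, and powers of $\Theta_1$ are controlled by some $\Theta_N$ (`exists_growth_le_Theta`).
For Poincaré growth $\Theta_0\ge1$ suffices. The local bounds are monotone in $A$, $B$, $N$
(`BoundAt.mono`), so compactness of $X$ makes the constants uniform. -/

noncomputable section

namespace LogLogForms

open Filter Topology

/-! ### Calculus of the Levi form -/

section Levi

variable {E : Type*} [NormedAddCommGroup E] [NormedSpace ℂ E]
  {F : Type*} [NormedAddCommGroup F] [NormedSpace ℂ F]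

/-- The Levi form `4 ∑ ∂_j ∂̄_k g w_j w̄_k` of a real function `g` at `z`, evaluated at `w`. -/
def levi (g : E → ℝ) (z w : E) : ℝ :=
  fderiv ℝ (fderiv ℝ g) z w w + fderiv ℝ (fderiv ℝ g) z (Complex.I • w) (Complex.I • w)

theorem levi_congr {g₁ g₂ : E → ℝ} {z : E} (h : g₁ =ᶠ[𝓝 z] g₂) (w : E) :
    levi g₁ z w = levi g₂ z w := by
  unfold levi
  rw [h.fderiv.fderiv_eq]

theorem ContDiffAt.differentiableAt_fderiv_real {G : Type*} [NormedAddCommGroup G]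
    [NormedSpace ℝ G] {g : E → G} {z : E} (hg : ContDiffAt ℝ 2 g z) :
    DifferentiableAt ℝ (fderiv ℝ g) z :=
  (hg.fderiv_right (m := 1) (by norm_num)).differentiableAt (by norm_num)

theorem ContDiffAt.eventually_differentiableAt_real {G : Type*} [NormedAddCommGroup G]
    [NormedSpace ℝ G] {g : E → G} {z : E} (hg : ContDiffAt ℝ 2 g z) :
    ∀ᶠ y in 𝓝 z, DifferentiableAt ℝ g y :=
  (hg.eventually (by simp)).mono fun _ hy => hy.differentiableAt (by norm_num)

/-- The second derivative of `ψ` is complex bilinear, so its contributions at $(w,w)$ and $(iw,iw)$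
cancel; only the Hessian of `g` survives. -/
theorem levi_comp {ψ : E → F} {g : F → ℝ} {z : E} (hψ : ContDiffAt ℂ 2 ψ z)
    (hg : ContDiffAt ℝ 2 g (ψ z)) (w : E) :
    levi (g ∘ ψ) z w = levi g (ψ z) (fderiv ℂ ψ z w) := by
  have hψd : ∀ᶠ y in 𝓝 z, DifferentiableAt ℂ ψ y :=
    (hψ.eventually (by simp)).mono fun _ hy => hy.differentiableAt (by norm_num)
  have hgd : ∀ᶠ y in 𝓝 z, DifferentiableAt ℝ g (ψ y) :=
    hψ.continuousAt.eventually (ContDiffAt.eventually_differentiableAt_real hg)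
  have e1 : fderiv ℝ (g ∘ ψ) =ᶠ[𝓝 z]
      fun y => (fderiv ℝ g (ψ y)).comp ((fderiv ℂ ψ y).restrictScalars ℝ) := by
    filter_upwards [hψd, hgd] with y h1 h2
    rw [fderiv_comp y h2 (h1.restrictScalars ℝ), h1.fderiv_restrictScalars ℝ]
  have hQ : HasFDerivAt (fderiv ℂ ψ) (fderiv ℂ (fderiv ℂ ψ) z) z :=
    ((hψ.fderiv_right (m := 1) (by norm_num)).differentiableAt (by norm_num)).hasFDerivAt
  have hψz : HasFDerivAt ψ (fderiv ℂ ψ z) z := hψd.self_of_nhds.hasFDerivAt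
  have hQ' : HasFDerivAt (fun y => (fderiv ℂ ψ y).restrictScalars ℝ)
      ((ContinuousLinearMap.restrictScalarsL ℂ E F ℝ ℝ).comp
        ((fderiv ℂ (fderiv ℂ ψ) z).restrictScalars ℝ)) z :=
    (ContinuousLinearMap.restrictScalarsL ℂ E F ℝ ℝ).hasFDerivAt.comp z (hQ.restrictScalars ℝ)
  have hG : HasFDerivAt (fun y => fderiv ℝ g (ψ y))
      ((fderiv ℝ (fderiv ℝ g) (ψ z)).comp ((fderiv ℂ ψ z).restrictScalars ℝ)) z :=
    (ContDiffAt.differentiableAt_fderiv_real hg).hasFDerivAt.comp z (hψz.restrictScalars ℝ)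
  have key := (e1.hasFDerivAt_iff.2 (hG.clm_comp hQ')).fderiv
  unfold levi
  rw [key]
  simp only [add_apply, ContinuousLinearMap.comp_apply,
    ContinuousLinearMap.compL_apply, ContinuousLinearMap.flip_apply,
    ContinuousLinearMap.coe_restrictScalars', map_smul]
  simp [smul_smul]
  ring

theorem levi_sum {κ : Type*} [Fintype κ] {g : κ → E → ℝ} {z : E}
    (hg : ∀ k, ContDiffAt ℝ 2 (g k) z) (w : E) :
    levi (fun y => ∑ k, g k y) z w = ∑ k, levi (g k) z w := by
  have e1 : fderiv ℝ (fun y => ∑ k, g k y) =ᶠ[𝓝 z] fun y => ∑ k, fderiv ℝ (g k) y := by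
    filter_upwards [eventually_all.2 fun k =>
      ContDiffAt.eventually_differentiableAt_real (hg k)] with y hy
    rw [fderiv_fun_sum fun k _ => hy k]
  unfold levi
  rw [e1.fderiv_eq, fderiv_fun_sum fun k _ => ContDiffAt.differentiableAt_fderiv_real (hg k)]
  simp [Finset.sum_add_distrib]

theorem levi_add {f g : E → ℝ} {z : E} (hf : ContDiffAt ℝ 2 f z)
    (hg : ContDiffAt ℝ 2 g z) (w : E) :
    levi (fun y => f y + g y) z w = levi f z w + levi g z w := by
  have e1 : fderiv ℝ (fun y => f y + g y) =ᶠ[𝓝 z] fun y => fderiv ℝ f y + fderiv ℝ g y := by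
    filter_upwards [ContDiffAt.eventually_differentiableAt_real hf,
      ContDiffAt.eventually_differentiableAt_real hg] with y h1 h2
    rw [fderiv_fun_add h1 h2]
  unfold levi
  rw [e1.fderiv_eq, fderiv_fun_add (ContDiffAt.differentiableAt_fderiv_real hf)
    (ContDiffAt.differentiableAt_fderiv_real hg)]
  simp; ring

theorem levi_const_mul (c : ℝ) {g : E → ℝ} {z : E} (hg : ContDiffAt ℝ 2 g z) (w : E) :
    levi (fun y => c * g y) z w = c * levi g z w := by
  have e1 : fderiv ℝ (fun y => c * g y) =ᶠ[𝓝 z] fun y => c • fderiv ℝ g y := by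
    filter_upwards [ContDiffAt.eventually_differentiableAt_real hg] with y h1
    exact fderiv_const_mul h1 c
  unfold levi
  rw [e1.fderiv_eq, fderiv_fun_const_smul (ContDiffAt.differentiableAt_fderiv_real hg)]
  simp; ring

theorem levi_re {H : E → ℂ} {z : E} (hH : ContDiffAt ℂ 2 H z) (w : E) :
    levi (fun y => (H y).re) z w = 0 := by
  have h := levi_comp (g := Complex.re) hH Complex.reCLM.contDiff.contDiffAt w
  have e : fderiv ℝ Complex.re = fun _ => Complex.reCLM := by
    funext y; exact Complex.reCLM.fderiv
  rw [show (fun y => (H y).re) = Complex.re ∘ H from rfl, h]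
  simp [levi, e]

/-- Up to a constant, $\log|H|$ is the real part of a holomorphic function near `z`: dividing by `H
z` brings the value to 1, where the principal logarithm is holomorphic. -/
theorem levi_log_norm {H : E → ℂ} {z : E} (hH : ContDiffAt ℂ 2 H z) (h0 : H z ≠ 0) (w : E) :
    levi (fun y => Real.log ‖H y‖) z w = 0 := by
  have hG : ContDiffAt ℂ 2 (fun y => Complex.log (H y / H z) + Real.log ‖H z‖) z := by
    refine ContDiffAt.add (ContDiffAt.comp z (Complex.contDiffAt_log ?_) (hH.div_const _))
      contDiffAt_const
    simp [div_self h0]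
  rw [← levi_re hG w]
  apply levi_congr
  filter_upwards [hH.continuousAt.eventually_ne h0] with y hy
  have : ‖H z‖ ≠ 0 := norm_ne_zero_iff.2 h0
  have : ‖H y‖ ≠ 0 := norm_ne_zero_iff.2 hy
  simp only [Complex.add_re, Complex.log_re, norm_div, Complex.ofReal_re]
  rw [Real.log_div ‹_› ‹_›]; ring

/-- The squared gradient term is the source of all the positivity in the theorem. -/
theorem levi_neg_log {u : E → ℝ} {z : E} (hu : ContDiffAt ℝ 2 u z) (h0 : 0 < u z) (w : E) :
    levi (fun y => -Real.log (u y)) z w =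
      ((fderiv ℝ u z w) ^ 2 + (fderiv ℝ u z (Complex.I • w)) ^ 2) / u z ^ 2
        - levi u z w / u z := by
  have hne : ∀ᶠ y in 𝓝 z, u y ≠ 0 := hu.continuousAt.eventually_ne h0.ne'
  have e1 : fderiv ℝ (fun y => -Real.log (u y)) =ᶠ[𝓝 z]
      fun y => (-(u y)⁻¹) • fderiv ℝ u y := by
    filter_upwards [hne, ContDiffAt.eventually_differentiableAt_real hu] with y h1 h2
    rw [(h2.hasFDerivAt.log h1).fun_neg.fderiv, neg_smul]
  have hud := (ContDiffAt.eventually_differentiableAt_real hu).self_of_nhds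
  have h2 : HasFDerivAt (fun y => -(u y)⁻¹) ((u z ^ 2)⁻¹ • fderiv ℝ u z) z := by
    have := ((hasDerivAt_inv h0.ne').comp_hasFDerivAt z hud.hasFDerivAt).fun_neg
    simpa [Function.comp_def] using this
  have key := (e1.hasFDerivAt_iff.2
    (h2.fun_smul (ContDiffAt.differentiableAt_fderiv_real hu).hasFDerivAt)).fderiv
  unfold levi
  rw [key]
  simp
  field_simp
  ring

end Levi

/-! ### The form $dd^cf$ as a Levi form -/

section DDC
variable {E : Type*} [NormedAddCommGroup E] [NormedSpace ℂ E]
  {X : Type*} [TopologicalSpace X] [ChartedSpace E X]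

/-- In the alternating sum the factor $i\cdot i=-1$ makes the $(v,v)$ term positive, and the sign of
the second summand does the same for $(iv,iv)$. -/
theorem extDeriv_dc_apply_I_smul {g : E → ℝ} {z : E} (hg : ContDiffAt ℝ 2 g z) (v : E) :
    extDeriv (dc g) z ![v, Complex.I • v] = (4 * Real.pi)⁻¹ * levi g z v := by
  have hd := ContDiffAt.differentiableAt_fderiv_real hg
  have hdc : DifferentiableAt ℝ (dc g) z := by
    have h1 : DifferentiableAt ℝ (fun y => (fderiv ℝ g y).comp (mulI (E := E))) z :=
      hd.clm_comp (differentiableAt_const _)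
    exact ((ContinuousAlternatingMap.ofSubsingletonLIE (𝕜 := ℝ) (E := E) (F := ℝ)
      (0 : Fin 1)).differentiableAt.comp z h1).const_smul (-(4 * Real.pi)⁻¹)
  have e : ∀ w u : E, fderiv ℝ (fun y => dc g y ![w]) z u =
      -(4 * Real.pi)⁻¹ * fderiv ℝ (fderiv ℝ g) z u (Complex.I • w) := by
    intro w u
    have : (fun y => dc g y ![w]) =
        fun y => (-(4 * Real.pi)⁻¹) * fderiv ℝ g y (Complex.I • w) := by
      funext y
      simp [dc, mulI]
    have h3 : HasFDerivAt (fun y => (-(4 * Real.pi)⁻¹) * fderiv ℝ g y (Complex.I • w)) _ z :=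
      (hd.hasFDerivAt.clm_apply (hasFDerivAt_const (Complex.I • w) z)).const_mul _
    rw [this, h3.fderiv]
    simp
  rw [extDeriv_apply hdc, Fin.sum_univ_two]
  have r0 : (0 : Fin 2).removeNth ![v, Complex.I • v] = ![Complex.I • v] := by
    ext i; fin_cases i; rfl
  have r1 : (1 : Fin 2).removeNth ![v, Complex.I • v] = ![v] := by
    ext i; fin_cases i; rfl
  rw [r0, r1, e, e]
  simp [levi, smul_smul]
  ring

theorem ddc_apply_I_smul {f : X → ℝ} {x : X}
    (hf : ContDiffAt ℝ 2 (f ∘ (chartAt E x).symm) (chartAt E x x))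
    (v : TangentSpace 𝓘(ℂ, E) x) :
    ddc f x ![v, Complex.I • v] =
      (4 * Real.pi)⁻¹ * levi (f ∘ (chartAt E x).symm) (chartAt E x x) v :=
  extDeriv_dc_apply_I_smul hf v

end DDC

/-! ### Lower bound for the Levi form of $-\log\log\|s\|^{-2}$ -/

section LowerBound

variable {E : Type*} [NormedAddCommGroup E] [NormedSpace ℂ E]

theorem ContDiffAt.log_norm_real {H : E → ℂ} {z : E} (hH : ContDiffAt ℂ 2 H z) (h0 : H z ≠ 0) :
    ContDiffAt ℝ 2 (fun y => Real.log ‖H y‖) z :=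
  ((hH.restrict_scalars ℝ).norm ℝ h0).log (norm_ne_zero_iff.2 h0)

theorem fderiv_log_norm_apply {H : E → ℂ} {z : E} (hH : DifferentiableAt ℂ H z) (h0 : H z ≠ 0)
    (w : E) : fderiv ℝ (fun y => Real.log ‖H y‖) z w = (fderiv ℂ H z w / H z).re := by
  have h1 : HasFDerivAt (fun y => H y / H z) ((H z)⁻¹ • fderiv ℂ H z) z := by
    simpa [div_eq_inv_mul] using hH.hasFDerivAt.const_mul (H z)⁻¹
  have h2 := (h1.clog (by simp [div_self h0])).restrictScalars ℝ
  have h3 := (Complex.reCLM.hasFDerivAt.comp z h2).add_const (Real.log ‖H z‖)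
  have e : (fun y => Real.log ‖H y‖) =ᶠ[𝓝 z]
      fun y => (Complex.reCLM ∘ fun y => Complex.log (H y / H z)) y + Real.log ‖H z‖ := by
    filter_upwards [hH.continuousAt.eventually_ne h0] with y hy
    simp only [Function.comp_apply, Complex.reCLM_apply, Complex.log_re, norm_div]
    rw [Real.log_div (norm_ne_zero_iff.2 hy) (norm_ne_zero_iff.2 h0)]; ring
  rw [(e.hasFDerivAt_iff.2 h3).fderiv]
  simp [div_self h0, div_eq_inv_mul]

theorem ContDiffAt.continuousAt_norm_fderiv {V G : Type*} [NormedAddCommGroup V] [NormedSpace ℝ V]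
    [NormedAddCommGroup G] [NormedSpace ℝ G] {g : V → G} {z : V} (hg : ContDiffAt ℝ 1 g z) :
    ContinuousAt (fun y => ‖fderiv ℝ g y‖) z :=
  (hg.fderiv_right (m := 0) (by norm_num)).continuousAt.norm

theorem abs_levi_le {g : E → ℝ} {z : E} {K : ℝ} (hK : ‖fderiv ℝ (fderiv ℝ g) z‖ ≤ K) (w : E) :
    |levi g z w| ≤ 2 * K * ‖w‖ ^ 2 := by
  have h : ∀ v : E, ‖v‖ = ‖w‖ → |fderiv ℝ (fderiv ℝ g) z v v| ≤ K * ‖w‖ ^ 2 := by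
    intro v hv
    calc |fderiv ℝ (fderiv ℝ g) z v v| ≤ ‖fderiv ℝ (fderiv ℝ g) z‖ * ‖v‖ * ‖v‖ :=
          (fderiv ℝ (fderiv ℝ g) z).le_opNorm₂ v v
      _ ≤ K * ‖w‖ * ‖w‖ := by rw [hv]; gcongr
      _ = K * ‖w‖ ^ 2 := by ring
  have h1 := h w rfl
  have h2 := h (Complex.I • w) (by simp [norm_smul])
  unfold levi
  rw [abs_le] at *
  constructor <;> linarith

/-- The function `log ‖s‖⁻²`, for a section with local expression `F` and `r = log ‖frame‖²`. -/
def logInvSq (F : E → ℂ) (r : E → ℝ) (z : E) : ℝ := -2 * Real.log ‖F z‖ - r z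

theorem contDiffAt_logInvSq {F : E → ℂ} {r : E → ℝ} {z : E} (hF : ContDiffAt ℂ 2 F z)
    (hr : ContDiffAt ℝ 2 r z) (h0 : F z ≠ 0) : ContDiffAt ℝ 2 (logInvSq F r) z :=
  (contDiffAt_const.mul (ContDiffAt.log_norm_real hF h0)).sub hr

/-- Pluriharmonicity of $\log|F|$ leaves only `r` in the Levi form of `logInvSq F r`. The constant
is therefore uniform near `a`, even as `z` approaches the zeros of `F`. -/
theorem levi_neg_log_logInvSq_lower {F : E → ℂ} {r : E → ℝ} {a : E} (hF : ContDiffAt ℂ 2 F a)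
    (hr : ContDiffAt ℝ 2 r a) :
    ∃ C : ℝ, 0 < C ∧ ∀ᶠ z in 𝓝 a, F z ≠ 0 → 1 ≤ logInvSq F r z →
      ∀ w, 2 * ‖fderiv ℂ F z w / F z‖ ^ 2 / logInvSq F r z ^ 2 - C * ‖w‖ ^ 2 ≤
        levi (fun y => -Real.log (logInvSq F r y)) z w := by
  have hr1 : ContDiffAt ℝ 1 (fderiv ℝ r) a := hr.fderiv_right (by norm_num)
  have hr2n : ContinuousAt (fun z => ‖fderiv ℝ (fderiv ℝ r) z‖) a :=
    ContDiffAt.continuousAt_norm_fderiv hr1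
  set K := ‖fderiv ℝ r a‖ + ‖fderiv ℝ (fderiv ℝ r) a‖ + 1 with hKdef
  have hK : 0 < K := by positivity
  have hk1 : ∀ᶠ z in 𝓝 a, ‖fderiv ℝ r z‖ < K :=
    hr1.continuousAt.norm.eventually_lt_const
      (by rw [hKdef]; linarith [norm_nonneg (fderiv ℝ (fderiv ℝ r) a)])
  have hk2 : ∀ᶠ z in 𝓝 a, ‖fderiv ℝ (fderiv ℝ r) z‖ < K :=
    hr2n.eventually_lt_const
      (by rw [hKdef]; linarith [norm_nonneg (fderiv ℝ r a)])
  -- `2 * K` pays for the Levi form of `r`, `2 * K ^ 2` for the cross terms with $dr$; as $U\ge1$,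
  -- dividing by $U$ or $U^2$ does not enlarge them.
  refine ⟨2 * K + 2 * K ^ 2, by positivity, ?_⟩
  filter_upwards [hk1, hk2, hF.eventually (by simp), hr.eventually (by simp)] with
    z hz1 hz2 hFz hrz h0 hU w
  set U := logInvSq F r with hUdef
  have hlog := ContDiffAt.log_norm_real hFz h0
  have hUs : ContDiffAt ℝ 2 U z := contDiffAt_logInvSq hFz hrz h0
  have hUpos : 0 < U z := by linarith
  have hlevi : levi U z w = -levi r z w := by
    have : U = fun y => (-2) * Real.log ‖F y‖ + (-1) * r y := by
      funext y; simp [hUdef, logInvSq]; ring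
    rw [this, levi_add (contDiffAt_const.mul hlog) (contDiffAt_const.mul hrz),
      levi_const_mul _ hlog, levi_const_mul _ hrz, levi_log_norm hFz h0]
    ring
  have hder : ∀ v, fderiv ℝ U z v = -2 * (fderiv ℂ F z v / F z).re - fderiv ℝ r z v := by
    intro v
    have h1 : HasFDerivAt U ((-2 : ℝ) • fderiv ℝ (fun y => Real.log ‖F y‖) z - fderiv ℝ r z) z :=
      ((hlog.differentiableAt (by norm_num)).hasFDerivAt.const_mul (-2)).fun_sub
        (hrz.differentiableAt (by norm_num)).hasFDerivAt
    rw [h1.fderiv]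
    simp [← fderiv_log_norm_apply (hFz.differentiableAt (by norm_num)) h0]
  rw [levi_neg_log hUs hUpos, hlevi, hder, hder]
  have hp : ∀ v : E, ‖v‖ = ‖w‖ → (fderiv ℝ r z v) ^ 2 ≤ K ^ 2 * ‖w‖ ^ 2 := by
    intro v hv
    have : |fderiv ℝ r z v| ≤ K * ‖w‖ := by
      rw [← hv]
      exact ((fderiv ℝ r z).le_opNorm v).trans (by gcongr)
    rw [← mul_pow, ← sq_abs]
    gcongr
  have hp1 := hp w rfl
  have hp2 := hp (Complex.I • w) (by simp [norm_smul])
  have hl := abs_le.1 (abs_levi_le hz2.le w)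
  set q := fderiv ℂ F z w / F z with hq
  -- The directions $w$ and $iw$ give the real and the imaginary part of $q$, so the two squared
  -- derivatives together recover $|q|^2$.
  have hqI : fderiv ℂ F z (Complex.I • w) / F z = Complex.I * q := by
    rw [map_smul, smul_eq_mul, mul_div_assoc]
  rw [hqI]
  have hqn : ‖q‖ ^ 2 = q.re ^ 2 + q.im ^ 2 := by
    rw [← Complex.normSq_eq_norm_sq, Complex.normSq_apply]; ring
  simp only [Complex.mul_re, Complex.I_re, Complex.I_im, zero_mul, one_mul, zero_sub]
  set p := fderiv ℝ r z w
  set p' := fderiv ℝ r z (Complex.I • w)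
  have hsq : 2 * ‖q‖ ^ 2 - 2 * K ^ 2 * ‖w‖ ^ 2 ≤
      (-2 * q.re - p) ^ 2 + (-2 * -q.im - p') ^ 2 := by
    rw [hqn]
    nlinarith [sq_nonneg (q.re + p), sq_nonneg (q.im - p')]
  have hU2 : 1 ≤ U z ^ 2 := one_le_pow₀ hU
  have h1 : (2 * ‖q‖ ^ 2 - 2 * K ^ 2 * ‖w‖ ^ 2) / U z ^ 2 ≤
      ((-2 * q.re - p) ^ 2 + (-2 * -q.im - p') ^ 2) / U z ^ 2 := by gcongr
  have h2 : 2 * K ^ 2 * ‖w‖ ^ 2 / U z ^ 2 ≤ 2 * K ^ 2 * ‖w‖ ^ 2 :=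
    div_le_self (by positivity) hU2
  have h3 : -levi r z w / U z ≤ 2 * K * ‖w‖ ^ 2 := by
    rw [div_le_iff₀ hUpos]
    have : 0 ≤ 2 * K * ‖w‖ ^ 2 := by positivity
    nlinarith
  rw [sub_div] at h1
  linarith

end LowerBound

/-! ### Simple zeros along a coordinate hyperplane -/

section Analytic

variable {E : Type*} [NormedAddCommGroup E] [NormedSpace ℂ E]

/-- By the identity theorem none of the functions vanishes on a whole open subset. The open set `V`
is arbitrary so that the induction can shrink it to where the last function is nonzero. -/
theorem exists_mem_forall_ne_zero {κ : Type*} {f : κ → E → ℂ} {U : Set E}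
    (hc : IsPreconnected U) (hf : ∀ k, AnalyticOnNhd ℂ (f k) U)
    (s : Finset κ) (hs : ∀ k ∈ s, ¬ EqOn (f k) 0 U) :
    ∀ V ⊆ U, IsOpen V → V.Nonempty → ∃ z ∈ V, ∀ k ∈ s, f k z ≠ 0 := by
  classical
  induction s using Finset.induction_on with
  | empty => intro V _ _ ⟨z, hz⟩; exact ⟨z, hz, by simp⟩
  | insert j s _ ih =>
    intro V hVU hV hne
    have hj : ∃ z ∈ V, f j z ≠ 0 := by
      by_contra! h0
      obtain ⟨z, hz⟩ := hne
      refine hs j (Finset.mem_insert_self _ _)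
        ((hf j).eqOn_zero_of_preconnected_of_eventuallyEq_zero hc (hVU hz) ?_)
      filter_upwards [hV.mem_nhds hz] with y hy using h0 y hy
    obtain ⟨z, hz, hzj⟩ := hj
    have hcont : ContinuousOn (f j) V := (hf j).continuousOn.mono hVU
    obtain ⟨y, hy, hyk⟩ := ih (fun k hk => hs k (Finset.mem_insert_of_mem hk))
      (V ∩ f j ⁻¹' {0}ᶜ) (inter_subset_left.trans hVU)
      (hcont.isOpen_inter_preimage hV isOpen_compl_singleton) ⟨z, hz, hzj⟩
    refine ⟨y, hy.1, fun k hk => ?_⟩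
    rcases Finset.mem_insert.1 hk with rfl | hk
    · exact hy.2
    · exact hyk k hk

variable {n : ℕ}

/-- The projection of `ℂⁿ` onto the hyperplane `z_i = 0`. -/
def dropCoord (i : Fin n) : (Fin n → ℂ) →L[ℂ] (Fin n → ℂ) :=
  ContinuousLinearMap.pi fun j => if j = i then 0 else ContinuousLinearMap.proj j

theorem dropCoord_apply (i j : Fin n) (z : Fin n → ℂ) :
    dropCoord i z j = if j = i then 0 else z j := by
  unfold dropCoord
  by_cases h : j = i <;> simp [h]

theorem add_single_eq (i : Fin n) (z : Fin n → ℂ) :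
    z = dropCoord i z + z i • Pi.single i (1 : ℂ) := by
  ext j
  by_cases h : j = i
  · subst h; simp [dropCoord_apply]
  · simp [dropCoord_apply, h]

theorem norm_dropCoord_le (i : Fin n) (z : Fin n → ℂ) : ‖dropCoord i z‖ ≤ ‖z‖ := by
  refine (pi_norm_le_iff_of_nonneg (norm_nonneg _)).2 fun j => ?_
  rw [dropCoord_apply]
  split_ifs
  · simp
  · exact norm_le_pi_norm z j

theorem dropCoord_mem_ball {i : Fin n} {a z : Fin n → ℂ} (ha : a i = 0) {δ : ℝ}
    (hz : z ∈ Metric.ball a δ) : dropCoord i z ∈ Metric.ball a δ := by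
  have : dropCoord i a = a := by
    ext j
    rw [dropCoord_apply]
    split_ifs with h
    · rw [h, ha]
    · rfl
  rw [mem_ball_iff_norm] at *
  nth_rewrite 1 [← this]
  rw [← map_sub]
  exact (norm_dropCoord_le i _).trans_lt hz

/-- The hyperplane is locally irreducible. Composing with the projection onto it gives analytic
functions on a ball; if none were identically zero, they would all be nonzero at a common point,
whose projection contradicts `h`. -/
theorem exists_eventually_vanishes_of_coord {κ : Type*} [Finite κ] {F : κ → (Fin n → ℂ) → ℂ}
    {a : Fin n → ℂ} {i : Fin n} (ha : a i = 0) (hF : ∀ k, AnalyticAt ℂ (F k) a)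
    (h : ∀ᶠ z in 𝓝 a, z i = 0 → ∃ k, F k z = 0) :
    ∃ k, ∀ᶠ z in 𝓝 a, z i = 0 → F k z = 0 := by
  have := Fintype.ofFinite κ
  have h2 : ∀ᶠ z in 𝓝 a, ∀ k, AnalyticAt ℂ (F k) z :=
    eventually_all.2 fun k => (hF k).eventually_analyticAt
  obtain ⟨δ, hδ, hball⟩ := Metric.eventually_nhds_iff_ball.1 (h.and h2)
  have han : ∀ k, AnalyticOnNhd ℂ (F k ∘ dropCoord i) (Metric.ball a δ) := fun k z hz =>
    ((hball _ (dropCoord_mem_ball ha hz)).2 k).comp ((dropCoord i).analyticAt z)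
  by_contra hcon
  rw [not_exists] at hcon
  obtain ⟨z, hz, hne⟩ := exists_mem_forall_ne_zero (convex_ball a δ).isPreconnected han
    Finset.univ (fun k _ heq => hcon k (Metric.eventually_nhds_iff_ball.2
      ⟨δ, hδ, fun z hz hzi => by
        have e : dropCoord i z = z := by
          ext j
          rw [dropCoord_apply]
          split_ifs with h
          · rw [h, hzi]
          · rfl
        have := heq hz
        simpa [e] using this⟩)) (Metric.ball a δ) subset_rfl Metric.isOpen_ball
      ⟨a, Metric.mem_ball_self hδ⟩
  obtain ⟨k, hk⟩ := (hball _ (dropCoord_mem_ball ha hz)).1 (by simp [dropCoord_apply])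
  exact hne k (Finset.mem_univ _) hk

/-- A quantitative form of $F=z_i\cdot$(unit), obtained without dividing, from a Lipschitz bound on
the derivative. Divided by $F\,z_i$, the last estimate says that $dF/F-dz_i/z_i$ is bounded. -/
theorem coord_estimates {F : (Fin n → ℂ) → ℂ} {a : Fin n → ℂ} {i : Fin n} (ha : a i = 0)
    (hF : ContDiffAt ℂ 2 F a) (h0 : ∀ᶠ z in 𝓝 a, z i = 0 → F z = 0)
    (hd : fderiv ℂ F a ≠ 0) :
    ∃ c C : ℝ, 0 < c ∧ 0 < C ∧ ∀ᶠ z in 𝓝 a, c * ‖z i‖ ≤ ‖F z‖ ∧ ‖F z‖ ≤ C * ‖z i‖ ∧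
      ∀ w, ‖z i * fderiv ℂ F z w - F z * w i‖ ≤ C * ‖z i‖ ^ 2 * ‖w‖ := by
  have hF1 : ContDiffAt ℂ 1 (fderiv ℂ F) a := hF.fderiv_right (by norm_num)
  obtain ⟨K, t, ht, hlip⟩ := hF1.exists_lipschitzOnWith
  have hdiff : ∀ᶠ z in 𝓝 a, DifferentiableAt ℂ F z :=
    (hF.eventually (by simp)).mono fun _ hy => hy.differentiableAt (by norm_num)
  obtain ⟨δ, hδ, hball⟩ := Metric.eventually_nhds_iff_ball.1
    ((h0.and hdiff).and (Filter.eventually_mem_set.2 ht))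
  set e : Fin n → ℂ := Pi.single i (1 : ℂ) with he
  have hsub : ∀ z : Fin n → ℂ, z - dropCoord i z = z i • e := fun z => by
    nth_rewrite 1 [add_single_eq i z]
    simp [he]
  have hen : ‖e‖ = 1 := by rw [he, Pi.norm_single, norm_one]
  -- At points of the hyperplane the derivative kills the tangent directions, because $F$ vanishes
  -- along it.
  have hvan : ∀ z ∈ Metric.ball a δ, ∀ w, fderiv ℂ F (dropCoord i z) (dropCoord i w) = 0 := by
    intro z hz w
    have h1 : HasFDerivAt (F ∘ dropCoord i)
        ((fderiv ℂ F (dropCoord i z)).comp (dropCoord i)) z :=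
      (hball _ (dropCoord_mem_ball ha hz)).1.2.hasFDerivAt.comp z (dropCoord i).hasFDerivAt
    have h2 : F ∘ dropCoord i =ᶠ[𝓝 z] fun _ => (0 : ℂ) := by
      filter_upwards [Metric.isOpen_ball.mem_nhds hz] with y hy
      exact (hball _ (dropCoord_mem_ball ha hy)).1.1 (by simp [dropCoord_apply])
    have h3 := h1.unique (h2.hasFDerivAt_iff.2 (hasFDerivAt_const _ _))
    exact congrArg (fun T => T w) h3
  -- Mean value inequality on the segment from the projection of `z`, where $F=0$, to `z`.
  have hT : ∀ z ∈ Metric.ball a δ, ‖F z - z i * fderiv ℂ F z e‖ ≤ K * ‖z i‖ ^ 2 := by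
    intro z hz
    have hseg : segment ℝ (dropCoord i z) z ⊆ Metric.ball a δ :=
      (convex_ball a δ).segment_subset (dropCoord_mem_ball ha hz) hz
    have := (convex_segment (𝕜 := ℝ) (dropCoord i z) z).norm_image_sub_le_of_norm_hasFDerivWithin_le'
      (f := F) (f' := fderiv ℂ F) (φ := fderiv ℂ F z) (C := K * ‖z i‖)
      (fun x hx => (hball x (hseg hx)).1.2.hasFDerivAt.hasFDerivWithinAt)
      (fun x hx => by
        refine (hlip.norm_sub_le (hball x (hseg hx)).2 (hball z hz).2).trans ?_
        gcongr
        calc ‖x - z‖ = ‖z - x‖ := norm_sub_rev _ _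
          _ ≤ ‖z - dropCoord i z‖ := by
              obtain ⟨p, q, hp, hq, hpq, rfl⟩ := hx
              have : z - (p • dropCoord i z + q • z) = p • (z - dropCoord i z) := by
                have : q = 1 - p := by linarith
                subst this
                module
              rw [this, norm_smul, Real.norm_of_nonneg hp]
              exact mul_le_of_le_one_left (norm_nonneg _) (by linarith)
          _ = ‖z i‖ := by rw [hsub, norm_smul, hen, mul_one])
      (left_mem_segment ℝ _ _) (right_mem_segment ℝ _ _)
    rw [(hball _ (dropCoord_mem_ball ha hz)).1.1 (by simp [dropCoord_apply]), hsub, map_smul,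
      norm_smul, hen, sub_zero, smul_eq_mul] at this
    linarith
  -- The derivative at `a` is nonzero but vanishes along the hyperplane, so it must see the
  -- transverse direction.
  have hea : fderiv ℂ F a e ≠ 0 := by
    intro h
    apply hd
    ext1 w
    have haa : dropCoord i a = a := by
      have := hsub a
      rw [ha, zero_smul, sub_eq_zero] at this
      exact this.symm
    have := hvan a (Metric.mem_ball_self hδ) w
    rw [haa] at this
    rw [add_single_eq i w, map_add, this, map_smul, ← he, h]
    simp
  set c := ‖fderiv ℂ F a e‖ with hc
  have hc0 : 0 < c := norm_pos_iff.2 hea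
  have hcont : ContinuousAt (fun z => ‖fderiv ℂ F z e‖) a :=
    (hF1.continuousAt.clm_apply continuousAt_const).norm
  have hcont2 : ContinuousAt (fun z : Fin n → ℂ => (K : ℝ) * ‖z i‖) a :=
    continuousAt_const.mul (continuous_apply i).continuousAt.norm
  have ev1 : ∀ᶠ z in 𝓝 a, c / 2 < ‖fderiv ℂ F z e‖ - K * ‖z i‖ :=
    (hcont.sub hcont2).eventually_const_lt (by simp [ha, ← hc]; linarith)
  have ev2 : ∀ᶠ z in 𝓝 a, ‖fderiv ℂ F z e‖ + K * ‖z i‖ < c + 1 :=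
    (hcont.add hcont2).eventually_lt_const (by simp [ha, ← hc])
  have hK : (0 : ℝ) ≤ K := K.2
  refine ⟨c / 2, c + 1 + 2 * K, by linarith, by positivity, ?_⟩
  filter_upwards [ev1, ev2, Metric.ball_mem_nhds a hδ] with z h1 h2 hz
  have hTz := hT z hz
  have hzi := norm_nonneg (z i)
  refine ⟨?_, ?_, fun w => ?_⟩
  · have := norm_sub_norm_le (z i * fderiv ℂ F z e) (F z)
    rw [norm_sub_rev, norm_mul] at this
    nlinarith
  · have := norm_le_norm_add_norm_sub' (F z) (z i * fderiv ℂ F z e)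
    rw [norm_mul] at this
    nlinarith
  -- Splitting `w` into tangential and transverse parts leaves a derivative difference, of size
  -- $O(|z_i|)$ by the Lipschitz bound, and the remainder of `hT`.
  · have hw : z i * fderiv ℂ F z w - F z * w i =
        z i * (fderiv ℂ F z (dropCoord i w) - fderiv ℂ F (dropCoord i z) (dropCoord i w))
          - w i * (F z - z i * fderiv ℂ F z e) := by
      rw [hvan z hz w]
      nth_rewrite 1 [add_single_eq i w]
      rw [map_add, map_smul, smul_eq_mul, ← he]
      ring
    have hl : ‖fderiv ℂ F z (dropCoord i w) - fderiv ℂ F (dropCoord i z) (dropCoord i w)‖ ≤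
        K * ‖z i‖ * ‖w‖ := by
      rw [← sub_apply]
      refine (ContinuousLinearMap.le_opNorm _ _).trans ?_
      have h5 := hlip.norm_sub_le (hball z hz).2 (hball _ (dropCoord_mem_ball ha hz)).2
      rw [hsub, norm_smul, hen, mul_one] at h5
      gcongr
      exact norm_dropCoord_le i w
    rw [hw]
    refine (norm_sub_le _ _).trans ?_
    rw [norm_mul, norm_mul]
    have hwi := norm_le_pi_norm w i
    calc ‖z i‖ * ‖fderiv ℂ F z (dropCoord i w) - fderiv ℂ F (dropCoord i z) (dropCoord i w)‖
          + ‖w i‖ * ‖F z - z i * fderiv ℂ F z e‖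
        ≤ ‖z i‖ * (K * ‖z i‖ * ‖w‖) + ‖w‖ * (K * ‖z i‖ ^ 2) := by gcongr
      _ = 2 * K * ‖z i‖ ^ 2 * ‖w‖ := by ring
      _ ≤ (c + 1 + 2 * K) * ‖z i‖ ^ 2 * ‖w‖ := by gcongr; linarith

end Analytic

/-! ### Comparison with the Poincaré metric in coordinates -/

section LocalModel

variable {n : ℕ}

theorem one_lt_log_inv {x : ℝ} (h0 : 0 < x) (h : x < (Real.exp 1)⁻¹) : 1 < Real.log x⁻¹ := by
  rw [Real.lt_log_iff_exp_lt (inv_pos.2 h0)]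
  exact (lt_inv_comm₀ h0 (Real.exp_pos 1)).1 h

/-- Since $|F|$ is comparable to $|z_i|$, the quantities $U=$ `logInvSq F r z` and $\log|z_i|^{-1}$
bound each other up to constants; and $dz_i/z_i$ is $dF/F$ up to a bounded form. -/
theorem zeta_bound_of_vanishes {F : (Fin n → ℂ) → ℂ} {r : (Fin n → ℂ) → ℝ} {a : Fin n → ℂ}
    {i : Fin n} (ha : a i = 0) (hF : ContDiffAt ℂ 2 F a) (hr : ContinuousAt r a)
    (h0 : ∀ᶠ z in 𝓝 a, z i = 0 → F z = 0) (hd : fderiv ℂ F a ≠ 0) :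
    ∃ C : ℝ, 0 < C ∧ ∀ᶠ z in 𝓝 a, z i ≠ 0 → F z ≠ 0 → Real.exp 1 ≤ logInvSq F r z →
      Real.log (Real.log ‖z i‖⁻¹) ≤ C * Real.log (logInvSq F r z) ∧
      ∀ w, ‖w i / (z i * (Real.log ‖z i‖⁻¹ : ℂ))‖ ^ 2 ≤
        C * (2 * ‖fderiv ℂ F z w / F z‖ ^ 2 / logInvSq F r z ^ 2 + ‖w‖ ^ 2) := by
  obtain ⟨c, C, hc, hC, hest⟩ := coord_estimates ha hF h0 hd
  set R := |r a| + 1 with hR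
  have hRpos : 0 < R := by positivity
  have hrR : ∀ᶠ z in 𝓝 a, |r z| < R := hr.abs.eventually_lt_const (by rw [hR]; linarith)
  have hsm : ∀ᶠ z in 𝓝 a, ‖z i‖ < (Real.exp 1)⁻¹ :=
    (continuous_apply i).continuousAt.norm.eventually_lt_const (by simp [ha, Real.exp_pos])
  set C1 := C / c with hC1
  set C2 := 2 + 2 * |Real.log c| + R with hC2
  set C3 := 1 + 2 * |Real.log C| + R with hC3
  have hC1p : 0 < C1 := by positivity
  have hC2p : 0 < C2 := by positivity
  have hC3p : 1 < C3 := by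
    have := abs_nonneg (Real.log C)
    rw [hC3]; linarith
  have hlC3 : 0 < Real.log C3 := Real.log_pos hC3p
  -- `Real.log C3 + 1` serves the log-log bound, where $\log U\ge1$ absorbs the additive constant;
  -- `C2 ^ 2` compares the denominators and `2 * C1 ^ 2` covers the bounded difference of
  -- logarithmic derivatives.
  refine ⟨Real.log C3 + 1 + C2 ^ 2 + 2 * C1 ^ 2, by positivity, ?_⟩
  filter_upwards [hest, hrR, hsm] with z ⟨hz1, hz2, hz3⟩ hzr hzs hzi hFz hU
  have hzi0 : 0 < ‖z i‖ := norm_pos_iff.2 hzi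
  have hF0 : 0 < ‖F z‖ := norm_pos_iff.2 hFz
  set l := Real.log ‖z i‖⁻¹ with hl
  have hl1 : 1 < l := one_lt_log_inv hzi0 hzs
  have hle : l = -Real.log ‖z i‖ := Real.log_inv _
  set U := logInvSq F r z with hUdef
  have hUe : U = -2 * Real.log ‖F z‖ - r z := rfl
  have hU1 : 1 ≤ U := by linarith [Real.add_one_le_exp (1 : ℝ)]
  have hlogU : 1 ≤ Real.log U := (Real.le_log_iff_exp_le (by linarith)).2 hU
  have hlF1 : Real.log c + Real.log ‖z i‖ ≤ Real.log ‖F z‖ := by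
    rw [← Real.log_mul hc.ne' hzi0.ne']
    exact Real.log_le_log (by positivity) hz1
  have hlF2 : Real.log ‖F z‖ ≤ Real.log C + Real.log ‖z i‖ := by
    rw [← Real.log_mul hC.ne' hzi0.ne']
    exact Real.log_le_log hF0 hz2
  have hUl : U ≤ C2 * l := by
    have := neg_abs_le (Real.log c)
    have := neg_abs_le (r z)
    have : (2 * |Real.log c| + R) * 1 ≤ (2 * |Real.log c| + R) * l := by gcongr
    rw [hUe, hC2]
    linarith
  have hlU : l ≤ C3 * U := by
    have := le_abs_self (Real.log C)
    have := le_abs_self (r z)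
    have : (2 * |Real.log C| + R) * 1 ≤ (2 * |Real.log C| + R) * U := by gcongr
    rw [hC3]
    linarith
  refine ⟨?_, fun w => ?_⟩
  · have h1 : Real.log l ≤ Real.log C3 + Real.log U := by
      rw [← Real.log_mul (by linarith) (by linarith)]
      exact Real.log_le_log (by linarith) hlU
    have h2 : 0 ≤ C2 ^ 2 * Real.log U := by positivity
    have h3 : 0 ≤ 2 * C1 ^ 2 * Real.log U := by positivity
    nlinarith
  · set q := fderiv ℂ F z w / F z with hq
    have hdiff : ‖q - w i / z i‖ ≤ C1 * ‖w‖ := by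
      have e : q - w i / z i = (z i * fderiv ℂ F z w - F z * w i) / (F z * z i) := by
        rw [hq]; field_simp
      rw [e, norm_div, norm_mul, div_le_iff₀ (by positivity)]
      refine (hz3 w).trans ?_
      have : C1 * ‖w‖ * (c * ‖z i‖ * ‖z i‖) ≤ C1 * ‖w‖ * (‖F z‖ * ‖z i‖) := by gcongr
      refine le_trans (le_of_eq ?_) this
      rw [hC1]; field_simp
    have hwz : ‖w i / z i‖ ^ 2 ≤ 2 * ‖q‖ ^ 2 + 2 * C1 ^ 2 * ‖w‖ ^ 2 := by
      have h1 : ‖w i / z i‖ ≤ ‖q‖ + C1 * ‖w‖ := by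
        have := norm_sub_norm_le (w i / z i) q
        rw [norm_sub_rev] at this
        linarith
      have h2 : ‖w i / z i‖ ^ 2 ≤ (‖q‖ + C1 * ‖w‖) ^ 2 := by gcongr
      nlinarith [sq_nonneg (‖q‖ - C1 * ‖w‖)]
    have hnorm : ‖w i / (z i * (l : ℂ))‖ ^ 2 = ‖w i / z i‖ ^ 2 / l ^ 2 := by
      rw [← div_div, norm_div, Complex.norm_real, Real.norm_of_nonneg (by linarith), div_pow]
    have h4 : 2 * ‖q‖ ^ 2 / l ^ 2 ≤ C2 ^ 2 * (2 * ‖q‖ ^ 2 / U ^ 2) := by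
      have : U ^ 2 ≤ (C2 * l) ^ 2 := by gcongr
      rw [← mul_div_assoc, div_le_div_iff₀ (by positivity) (by positivity)]
      calc 2 * ‖q‖ ^ 2 * U ^ 2 ≤ 2 * ‖q‖ ^ 2 * (C2 * l) ^ 2 := by gcongr
        _ = _ := by ring
    have h5 : 2 * C1 ^ 2 * ‖w‖ ^ 2 / l ^ 2 ≤ 2 * C1 ^ 2 * ‖w‖ ^ 2 :=
      div_le_self (by positivity) (one_le_pow₀ hl1.le)
    rw [hnorm]
    set Q := 2 * ‖q‖ ^ 2 / U ^ 2 with hQ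
    have hQ0 : 0 ≤ Q := by positivity
    have hk1 : C2 ^ 2 ≤ Real.log C3 + 1 + C2 ^ 2 + 2 * C1 ^ 2 := by
      have : 0 ≤ C1 ^ 2 := sq_nonneg _
      linarith
    have hk2 : 2 * C1 ^ 2 ≤ Real.log C3 + 1 + C2 ^ 2 + 2 * C1 ^ 2 := by
      have : 0 ≤ C2 ^ 2 := sq_nonneg _
      linarith
    calc ‖w i / z i‖ ^ 2 / l ^ 2 ≤ (2 * ‖q‖ ^ 2 + 2 * C1 ^ 2 * ‖w‖ ^ 2) / l ^ 2 := by gcongr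
      _ = 2 * ‖q‖ ^ 2 / l ^ 2 + 2 * C1 ^ 2 * ‖w‖ ^ 2 / l ^ 2 := add_div _ _ _
      _ ≤ C2 ^ 2 * Q + 2 * C1 ^ 2 * ‖w‖ ^ 2 := add_le_add h4 h5
      _ ≤ (Real.log C3 + 1 + C2 ^ 2 + 2 * C1 ^ 2) * Q
          + (Real.log C3 + 1 + C2 ^ 2 + 2 * C1 ^ 2) * ‖w‖ ^ 2 :=
        add_le_add (mul_le_mul_of_nonneg_right hk1 hQ0)
          (mul_le_mul_of_nonneg_right hk2 (sq_nonneg _))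
      _ = _ := (mul_add _ _ _).symm

theorem zeta_bound_of_ne_zero {a : Fin n → ℂ} {i : Fin n} (ha : a i ≠ 0)
    (hsm : ‖a i‖ < (Real.exp 1)⁻¹) :
    ∃ C : ℝ, 0 < C ∧ ∀ᶠ z in 𝓝 a, Real.log (Real.log ‖z i‖⁻¹) ≤ C ∧
      ∀ w : Fin n → ℂ, ‖w i / (z i * (Real.log ‖z i‖⁻¹ : ℂ))‖ ^ 2 ≤ C * ‖w‖ ^ 2 := by
  set d := ‖a i‖ / 2 with hd
  have hd0 : 0 < d := by have := norm_pos_iff.2 ha; positivity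
  have hda : d < ‖a i‖ := by rw [hd]; linarith
  have hc : ContinuousAt (fun z : Fin n → ℂ => ‖z i‖) a := (continuous_apply i).continuousAt.norm
  refine ⟨|Real.log (Real.log d⁻¹)| + (d ^ 2)⁻¹, by positivity, ?_⟩
  filter_upwards [hc.eventually_const_lt hda, hc.eventually_lt_const hsm] with z h1 h2
  have hz0 : 0 < ‖z i‖ := hd0.trans h1
  have hl := one_lt_log_inv hz0 h2
  refine ⟨?_, fun w => ?_⟩
  · have h3 : Real.log ‖z i‖⁻¹ ≤ Real.log d⁻¹ :=
      Real.log_le_log (by positivity) (by gcongr)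
    have h4 := Real.log_le_log (by linarith) h3
    have h5 := le_abs_self (Real.log (Real.log d⁻¹))
    have : 0 < (d ^ 2)⁻¹ := by positivity
    linarith
  · have : ‖w i / (z i * (Real.log ‖z i‖⁻¹ : ℂ))‖ ≤ d⁻¹ * ‖w‖ := by
      rw [norm_div, norm_mul, Complex.norm_real, Real.norm_of_nonneg (by linarith),
        ← div_eq_inv_mul]
      have := norm_le_pi_norm w i
      gcongr
      nlinarith
    calc ‖w i / (z i * (Real.log ‖z i‖⁻¹ : ℂ))‖ ^ 2 ≤ (d⁻¹ * ‖w‖) ^ 2 := by gcongr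
      _ = (d ^ 2)⁻¹ * ‖w‖ ^ 2 := by rw [mul_pow, inv_pow]
      _ ≤ _ := by gcongr; linarith [abs_nonneg (Real.log (Real.log d⁻¹))]

theorem one_le_log_of_exp_le {x : ℝ} (h : Real.exp 1 ≤ x) : 1 ≤ Real.log x :=
  (Real.le_log_iff_exp_le ((Real.exp_pos 1).trans_le h)).2 h

variable {κ : Type*} [Fintype κ]

/-- If $a_i=0$, one index `k` gives the bound and the other summands are nonnegative. Otherwise
$d\zeta_i$ is bounded near `a`, and the constant is absorbed because each $\log U_k\ge1$. -/
theorem zeta_bound [Nonempty κ] {F : κ → (Fin n → ℂ) → ℂ} {r : κ → (Fin n → ℂ) → ℝ}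
    {a : Fin n → ℂ} {i : Fin n} (hsm : ‖a i‖ < (Real.exp 1)⁻¹) (hF : ∀ k, AnalyticAt ℂ (F k) a)
    (hr : ∀ k, ContinuousAt (r k) a) (h0 : ∀ᶠ z in 𝓝 a, z i = 0 → ∃ k, F k z = 0)
    (hd : ∀ k, F k a = 0 → fderiv ℂ (F k) a ≠ 0) :
    ∃ C : ℝ, 0 < C ∧ ∀ᶠ z in 𝓝 a, z i ≠ 0 → (∀ k, F k z ≠ 0) →
      (∀ k, Real.exp 1 ≤ logInvSq (F k) (r k) z) →
      Real.log (Real.log ‖z i‖⁻¹) ≤ C * ∑ k, Real.log (logInvSq (F k) (r k) z) ∧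
      ∀ w, ‖w i / (z i * (Real.log ‖z i‖⁻¹ : ℂ))‖ ^ 2 ≤
        C * (∑ k, 2 * ‖fderiv ℂ (F k) z w / F k z‖ ^ 2 / logInvSq (F k) (r k) z ^ 2
          + ‖w‖ ^ 2) := by
  by_cases ha : a i = 0
  · obtain ⟨k, hk⟩ := exists_eventually_vanishes_of_coord ha hF h0
    obtain ⟨C, hC, hev⟩ := zeta_bound_of_vanishes ha (hF k).contDiffAt (hr k) hk
      (hd k (hk.self_of_nhds ha))
    refine ⟨C, hC, hev.mono fun z hz hzi hFz hU => ?_⟩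
    obtain ⟨h1, h2⟩ := hz hzi (hFz k) (hU k)
    refine ⟨h1.trans ?_, fun w => (h2 w).trans ?_⟩
    · gcongr
      exact Finset.single_le_sum
        (f := fun k => Real.log (logInvSq (F k) (r k) z))
        (fun j _ => zero_le_one.trans (one_le_log_of_exp_le (hU j))) (Finset.mem_univ k)
    · gcongr
      exact Finset.single_le_sum
        (f := fun k => 2 * ‖fderiv ℂ (F k) z w / F k z‖ ^ 2 / logInvSq (F k) (r k) z ^ 2)
        (fun j _ => by positivity) (Finset.mem_univ k)
  · obtain ⟨C, hC, hev⟩ := zeta_bound_of_ne_zero ha hsm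
    refine ⟨C, hC, hev.mono fun z ⟨h1, h2⟩ _ _ hU => ?_⟩
    refine ⟨h1.trans (le_mul_of_one_le_right hC.le ?_), fun w => (h2 w).trans ?_⟩
    · obtain ⟨k⟩ := ‹Nonempty κ›
      refine (one_le_log_of_exp_le (hU k)).trans (Finset.single_le_sum
        (f := fun k => Real.log (logInvSq (F k) (r k) z))
        (fun j _ => zero_le_one.trans (one_le_log_of_exp_le (hU j))) (Finset.mem_univ k))
    · gcongr
      exact le_add_of_nonneg_left (Finset.sum_nonneg fun k _ => by positivity)

theorem exists_uniform_const {ι α : Type*} [Finite ι] {l : Filter α} {P : ι → ℝ → α → Prop}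
    (hmono : ∀ i x, Monotone fun C => P i C x) (h : ∀ i, ∃ C, 0 < C ∧ ∀ᶠ x in l, P i C x) :
    ∃ C, 0 < C ∧ ∀ᶠ x in l, ∀ i, P i C x := by
  have := Fintype.ofFinite ι
  choose C hC hev using h
  refine ⟨1 + ∑ i, C i, by have := Finset.sum_nonneg fun i (_ : i ∈ Finset.univ) => (hC i).le
                           linarith, ?_⟩
  refine eventually_all.2 fun i => (hev i).mono fun x hx => hmono i x ?_ hx
  have := Finset.single_le_sum (fun i (_ : i ∈ Finset.univ) => (hC i).le) (Finset.mem_univ i)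
  linarith

/-- The components of the tangent vector `w` at `z` in the frame dual to the `dζ_i`. -/
def zetaModel (m : ℕ) (z w : Fin n → ℂ) (i : Fin n) : ℂ :=
  if i.val < m then w i / (z i * (Real.log ‖z i‖⁻¹ : ℂ)) else w i

/-- The local core: up to a Euclidean correction, the Levi form of $-\Theta_1$ dominates the
Poincaré metric, while $\Theta_1$ dominates each $\log\log|z_i|^{-1}$. -/
theorem local_poincare_bound [Nonempty κ] {F : κ → (Fin n → ℂ) → ℂ} {r : κ → (Fin n → ℂ) → ℝ}
    {a : Fin n → ℂ} {m : ℕ} (hsm : ∀ i, ‖a i‖ < (Real.exp 1)⁻¹)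
    (hF : ∀ k, AnalyticAt ℂ (F k) a) (hr : ∀ k, ContDiffAt ℝ 2 (r k) a)
    (h0 : ∀ᶠ z in 𝓝 a, (∃ k, F k z = 0) ↔ ∃ i : Fin n, i.val < m ∧ z i = 0)
    (hd : ∀ k, F k a = 0 → fderiv ℂ (F k) a ≠ 0) :
    ∃ C : ℝ, 0 < C ∧ ∀ᶠ z in 𝓝 a, (∀ k, F k z ≠ 0) →
      (∀ k, Real.exp 1 ≤ logInvSq (F k) (r k) z) →
      (∀ i : Fin n, i.val < m →
        Real.log (Real.log ‖z i‖⁻¹) ≤ C * ∑ k, Real.log (logInvSq (F k) (r k) z)) ∧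
      (ContDiffAt ℝ 2 (fun y => ∑ k, -Real.log (logInvSq (F k) (r k) y)) z) ∧
      ∀ w, ∑ i, ‖zetaModel m z w i‖ ^ 2 ≤
        C * (levi (fun y => ∑ k, -Real.log (logInvSq (F k) (r k) y)) z w + C * ‖w‖ ^ 2) := by
  obtain ⟨C₁, hC₁, hlow⟩ := exists_uniform_const (ι := κ) (l := 𝓝 a)
    (P := fun k C z => F k z ≠ 0 → 1 ≤ logInvSq (F k) (r k) z → ∀ w,
      2 * ‖fderiv ℂ (F k) z w / F k z‖ ^ 2 / logInvSq (F k) (r k) z ^ 2 - C * ‖w‖ ^ 2 ≤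
        levi (fun y => -Real.log (logInvSq (F k) (r k) y)) z w)
    (fun k z C C' hCC h h1 h2 w => by
      refine le_trans ?_ (h h1 h2 w)
      gcongr)
    (fun k => levi_neg_log_logInvSq_lower (hF k).contDiffAt (hr k))
  obtain ⟨C₂, hC₂, hz⟩ := exists_uniform_const (ι := {i : Fin n // i.val < m}) (l := 𝓝 a)
    (P := fun i C z => (∀ k, F k z ≠ 0) →
      (∀ k, Real.exp 1 ≤ logInvSq (F k) (r k) z) →
      Real.log (Real.log ‖z i‖⁻¹) ≤ C * ∑ k, Real.log (logInvSq (F k) (r k) z) ∧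
      ∀ w : Fin n → ℂ, ‖w i / (z i * (Real.log ‖z i‖⁻¹ : ℂ))‖ ^ 2 ≤
        C * (∑ k, 2 * ‖fderiv ℂ (F k) z w / F k z‖ ^ 2 / logInvSq (F k) (r k) z ^ 2
          + ‖w‖ ^ 2))
    (fun i z C C' hCC h h1 h2 => by
      refine ⟨(h h1 h2).1.trans ?_, fun w => ((h h1 h2).2 w).trans ?_⟩
      · have := Finset.sum_nonneg fun k (_ : k ∈ Finset.univ) =>
          zero_le_one.trans (one_le_log_of_exp_le (h2 k))
        gcongr
      · have := Finset.sum_nonneg fun k (_ : k ∈ Finset.univ) =>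
          (by positivity :
            0 ≤ 2 * ‖fderiv ℂ (F k) z w / F k z‖ ^ 2 / logInvSq (F k) (r k) z ^ 2)
        gcongr)
    (fun i => by
      obtain ⟨C, hC, hev⟩ := zeta_bound (hsm i) hF (fun k => (hr k).continuousAt)
        (h0.mono fun z hz hzi => hz.2 ⟨i, i.2, hzi⟩) hd
      refine ⟨C, hC, ?_⟩
      filter_upwards [hev, h0] with z h1 h2 h3
      exact h1 (fun hzi => by obtain ⟨k, hk⟩ := h2.2 ⟨i, i.2, hzi⟩; exact h3 k hk) h3)
  set N : ℝ := (Fintype.card κ : ℝ)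
  have hN : 0 ≤ N := Nat.cast_nonneg _
  -- The first term pays for summing over the coordinates, `N * C₁` for the Euclidean errors of the
  -- `N` summands, and the last 1 for the extra `‖w‖ ^ 2` in `hi`.
  set C := (n + 1) * (C₂ + 1) + N * C₁ + 1 with hC
  have hCp : 0 < C := by positivity
  refine ⟨C, hCp, ?_⟩
  have hFs : ∀ᶠ z in 𝓝 a, ∀ k, ContDiffAt ℂ 2 (F k) z := eventually_all.2 fun k =>
    ((hF k).contDiffAt (n := 2)).eventually (by simp)
  have hrs : ∀ᶠ z in 𝓝 a, ∀ k, ContDiffAt ℝ 2 (r k) z := eventually_all.2 fun k =>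
    (hr k).eventually (by simp)
  filter_upwards [hlow, hz, hFs, hrs] with z h1 h2 h3 h4 hne hU
  have hU1 : ∀ k, 1 ≤ logInvSq (F k) (r k) z := fun k =>
    (Real.one_le_exp zero_le_one).trans (hU k)
  have hsm : ∀ k, ContDiffAt ℝ 2 (fun y => -Real.log (logInvSq (F k) (r k) y)) z := fun k =>
    ((contDiffAt_logInvSq (h3 k) (h4 k) (hne k)).log (by linarith [hU1 k])).neg
  refine ⟨fun i hi => ((h2 ⟨i, hi⟩ hne hU).1).trans ?_, ContDiffAt.sum fun k _ => hsm k,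
    fun w => ?_⟩
  · have := Finset.sum_nonneg fun k (_ : k ∈ Finset.univ) =>
      zero_le_one.trans (one_le_log_of_exp_le (hU k))
    gcongr
    have : 0 ≤ n * (C₂ + 1) + N * C₁ := by positivity
    linarith
  · rw [levi_sum hsm]
    set S := ∑ k, 2 * ‖fderiv ℂ (F k) z w / F k z‖ ^ 2 / logInvSq (F k) (r k) z ^ 2 with hS
    set Λ := ∑ k, levi (fun y => -Real.log (logInvSq (F k) (r k) y)) z w with hΛ
    have hS0 : 0 ≤ S := Finset.sum_nonneg fun k _ => by positivity
    have hSΛ : S - N * (C₁ * ‖w‖ ^ 2) ≤ Λ := by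
      have := Finset.sum_le_sum fun k (_ : k ∈ Finset.univ) => h1 k (hne k) (hU1 k) w
      rwa [Finset.sum_sub_distrib, Finset.sum_const, Finset.card_univ, nsmul_eq_mul] at this
    have hi : ∀ i : Fin n, ‖zetaModel m z w i‖ ^ 2 ≤ (C₂ + 1) * (S + ‖w‖ ^ 2) := by
      intro i
      unfold zetaModel
      split_ifs with him
      · refine ((h2 ⟨i, him⟩ hne hU).2 w).trans ?_
        gcongr
        linarith
      · have := norm_le_pi_norm w i
        calc ‖w i‖ ^ 2 ≤ ‖w‖ ^ 2 := by gcongr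
          _ ≤ S + ‖w‖ ^ 2 := by linarith
          _ ≤ (C₂ + 1) * (S + ‖w‖ ^ 2) := le_mul_of_one_le_left (by positivity) (by linarith)
    have hw2 : 0 ≤ ‖w‖ ^ 2 := by positivity
    have hn : (0 : ℝ) ≤ n := Nat.cast_nonneg n
    calc ∑ i, ‖zetaModel m z w i‖ ^ 2 ≤ ∑ _i : Fin n, (C₂ + 1) * (S + ‖w‖ ^ 2) :=
          Finset.sum_le_sum fun i _ => hi i
      _ = n * (C₂ + 1) * (S + ‖w‖ ^ 2) := by simp; ring
      _ ≤ C * (S + ‖w‖ ^ 2) := by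
          gcongr
          have : 0 ≤ N * C₁ := by positivity
          linarith
      _ ≤ C * (Λ + C * ‖w‖ ^ 2) := by
          gcongr ?_ * ?_
          have : (N * C₁ + 1) * ‖w‖ ^ 2 ≤ C * ‖w‖ ^ 2 := by
            gcongr
            have : 0 ≤ (n + 1) * (C₂ + 1) := by positivity
            linarith
          linarith

end LocalModel

/-! ### Change of chart -/

section Transport

variable {E : Type*} [NormedAddCommGroup E] [NormedSpace ℂ E]
  {X : Type*} [TopologicalSpace X] [ChartedSpace E X]

/-- The coordinates in the chart `φ` of the tangent vector `v` at `x`. -/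
def chartVec (φ : OpenPartialHomeomorph X E) (x : X) (v : TangentSpace 𝓘(ℂ, E) x) : E :=
  mfderiv 𝓘(ℂ, E) 𝓘(ℂ, E) φ x v

theorem contDiffAt_comp_chartAt_symm [IsManifold 𝓘(ℂ, E) ω X]
    {φ : OpenPartialHomeomorph X E}
    (hφ : φ ∈ IsManifold.maximalAtlas 𝓘(ℂ, E) ω X) {x : X} (hx : x ∈ φ.source) :
    ContDiffAt ℂ ω (φ ∘ (chartAt E x).symm) (chartAt E x x) := by
  rw [← contMDiffAt_iff_contDiffAt]
  have h1 := contMDiffAt_symm_of_mem_maximalAtlas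
    (IsManifold.chart_mem_maximalAtlas (I := 𝓘(ℂ, E)) (n := ω) x) (mem_chart_target E x)
  refine ContMDiffAt.comp (I' := 𝓘(ℂ, E)) _ ?_ h1
  rw [(chartAt E x).left_inv (mem_chart_source E x)]
  exact contMDiffAt_of_mem_maximalAtlas hφ hx

theorem contDiffAt_chartAt_comp_symm [IsManifold 𝓘(ℂ, E) ω X]
    {φ : OpenPartialHomeomorph X E}
    (hφ : φ ∈ IsManifold.maximalAtlas 𝓘(ℂ, E) ω X) {x : X} (hx : x ∈ φ.source) :
    ContDiffAt ℂ ω (chartAt E x ∘ φ.symm) (φ x) := by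
  rw [← contMDiffAt_iff_contDiffAt]
  have h1 := contMDiffAt_symm_of_mem_maximalAtlas hφ (φ.map_source hx)
  refine ContMDiffAt.comp (I' := 𝓘(ℂ, E)) _ ?_ h1
  rw [φ.left_inv hx]
  exact contMDiffAt_of_mem_maximalAtlas (IsManifold.chart_mem_maximalAtlas x)
    (mem_chart_source E x)

/-- Real smoothness is read in the preferred chart; the transition to `φ` is holomorphic, hence real
smooth. -/
theorem contDiffAt_comp_symm_of_smoothOn [IsManifold 𝓘(ℂ, E) ω X]
    {G : Type*} [NormedAddCommGroup G] [NormedSpace ℝ G]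
    {f : X → G} {U : Set X} (hf : SmoothOn (E := E) f U) {φ : OpenPartialHomeomorph X E}
    (hφ : φ ∈ IsManifold.maximalAtlas 𝓘(ℂ, E) ω X) {x : X} (hx : x ∈ φ.source)
    (hU : U ∈ 𝓝 x) : ContDiffAt ℝ 2 (f ∘ φ.symm) (φ x) := by
  have h1 : ContMDiffAt 𝓘(ℝ, E) 𝓘(ℝ, G) ∞ f x := ContMDiffOn.contMDiffAt hf hU
  have h2 : ContDiffAt ℝ ∞ (f ∘ (chartAt E x).symm) (chartAt E x x) := by
    have := (contMDiffAt_iff.1 h1).2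
    simpa [Function.comp_def, contDiffWithinAt_univ, chartAt_self_eq] using this
  have h3 := (contDiffAt_chartAt_comp_symm hφ hx).restrict_scalars ℝ
  have h4 : ContDiffAt ℝ 2 ((f ∘ (chartAt E x).symm) ∘ (chartAt E x ∘ φ.symm)) (φ x) := by
    refine ContDiffAt.comp _ ?_ (h3.of_le le_top)
    rw [Function.comp_apply, φ.left_inv hx]
    exact h2.of_le (WithTop.coe_le_coe.2 le_top)
  refine h4.congr_of_eventuallyEq ?_
  have h5 : ContinuousAt φ.symm (φ x) := φ.continuousAt_symm (φ.map_source hx)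
  have h6 : (chartAt E x).source ∈ 𝓝 (φ.symm (φ x)) := by
    rw [φ.left_inv hx]; exact chart_source_mem_nhds E x
  filter_upwards [h5 h6] with z hz
  simp only [Function.comp_apply]
  rw [(chartAt E x).left_inv hz]

theorem chartVec_eq_fderiv {φ : OpenPartialHomeomorph X E}
    (hφ : φ ∈ IsManifold.maximalAtlas 𝓘(ℂ, E) ω X) {x : X} (hx : x ∈ φ.source)
    (v : TangentSpace 𝓘(ℂ, E) x) :
    chartVec φ x v = fderiv ℂ (φ ∘ (chartAt E x).symm) (chartAt E x x) v := by
  have h := (contMDiffAt_of_mem_maximalAtlas hφ hx).mdifferentiableAt (by simp)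
  refine (congrArg (fun T : E →L[ℂ] E => T v) h.mfderiv).trans ?_
  simp only [writtenInExtChartAt, extChartAt_model_space_eq_id]
  simp [fderivWithin_univ, Function.comp_def]

/-- The preferred chart defining `ddc` varies with the point. Invariance of the Levi form under
holomorphic maps lets one chart serve a whole neighbourhood. -/
theorem ddc_eq_levi_chart [IsManifold 𝓘(ℂ, E) ω X]
    {f : X → ℝ} {φ : OpenPartialHomeomorph X E}
    (hφ : φ ∈ IsManifold.maximalAtlas 𝓘(ℂ, E) ω X) {x : X} (hx : x ∈ φ.source)
    (hf : ContDiffAt ℝ 2 (f ∘ φ.symm) (φ x)) (v : TangentSpace 𝓘(ℂ, E) x) :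
    ddc f x ![v, Complex.I • v] = (4 * Real.pi)⁻¹ *
      levi (f ∘ φ.symm) (φ x) (chartVec φ x v) := by
  set c := chartAt E x
  have hψ := contDiffAt_comp_chartAt_symm hφ hx
  have hψx : (φ ∘ c.symm) (c x) = φ x := by
    rw [Function.comp_apply, c.left_inv (mem_chart_source E x)]
  have hcs : ContinuousAt c.symm (c x) := c.continuousAt_symm (mem_chart_target E x)
  have hsrc : φ.source ∈ 𝓝 (c.symm (c x)) := by
    rw [c.left_inv (mem_chart_source E x)]; exact φ.open_source.mem_nhds hx
  have he : f ∘ c.symm =ᶠ[𝓝 (c x)] (f ∘ φ.symm) ∘ (φ ∘ c.symm) := by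
    filter_upwards [hcs hsrc] with z hz
    simp only [Function.comp_apply]
    rw [φ.left_inv hz]
  rw [← hψx] at hf
  have hf' : ContDiffAt ℝ 2 (f ∘ c.symm) (c x) :=
    (hf.comp _ ((hψ.restrict_scalars ℝ).of_le le_top)).congr_of_eventuallyEq he
  refine (ddc_apply_I_smul hf' v).trans (congrArg _ ?_)
  rw [chartVec_eq_fderiv hφ hx]
  exact (levi_congr he _).trans ((levi_comp (hψ.of_le le_top) hf _).trans (by rw [hψx]))

theorem chartVec_surjective {φ : OpenPartialHomeomorph X E}
    (hφ : φ ∈ IsManifold.maximalAtlas 𝓘(ℂ, E) ω X) {x : X} (hx : x ∈ φ.source) :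
    Function.Surjective (chartVec φ x) := by
  have h : φ.MDifferentiable 𝓘(ℂ, E) 𝓘(ℂ, E) :=
    ⟨(contMDiffOn_of_mem_maximalAtlas hφ).mdifferentiableOn (by simp),
      (contMDiffOn_symm_of_mem_maximalAtlas hφ).mdifferentiableOn (by simp)⟩
  exact h.mfderiv_surjective hx

theorem chartVec_zero (φ : OpenPartialHomeomorph X E) (x : X) : chartVec φ x 0 = 0 :=
  map_zero (mfderiv 𝓘(ℂ, E) 𝓘(ℂ, E) φ x)

end Transport

/-! ### Adapted charts and pointwise bounds on (1,1)-forms -/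

section AdaptedCharts

variable {n : ℕ} {X : Type*} [TopologicalSpace X] [ChartedSpace (Fin n → ℂ) X]

theorem dz_apply {φ : OpenPartialHomeomorph X (Fin n → ℂ)} (hφ : IsHolChart φ) {x : X}
    (hx : x ∈ φ.source) (k : Fin n) (v : TangentSpace 𝓘(ℂ, Fin n → ℂ) x) :
    dz φ k x v = chartVec φ x v k := by
  have h1 := ((contMDiffAt_of_mem_maximalAtlas hφ hx).mdifferentiableAt (by simp)).hasMFDerivAt
  have h2 := (ContinuousLinearMap.proj (R := ℂ) (φ := fun _ : Fin n => ℂ) k).hasMFDerivAt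
    (x := φ x)
  have h3 := h2.comp x h1
  unfold dz
  have h4 : mfderiv 𝓘(ℂ, Fin n → ℂ) 𝓘(ℂ, ℂ) (fun y => φ y k) x = _ := h3.mfderiv
  rw [h4]
  rfl

theorem dzeta_apply {φ : OpenPartialHomeomorph X (Fin n → ℂ)} (hφ : IsHolChart φ) {x : X}
    (hx : x ∈ φ.source) (m : ℕ) (k : Fin n) (v : TangentSpace 𝓘(ℂ, Fin n → ℂ) x) :
    dzeta φ m k x v = zetaModel m (φ x)
      (chartVec φ x v) k := by
  unfold dzeta zetaModel
  rw [dz_apply hφ hx]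

theorem exists_isAdapted [IsManifold 𝓘(ℂ, Fin n → ℂ) ω X]
    {D : Set X} (hD : IsNormalCrossings (n := n) D) (x : X) :
    ∃ (φ : OpenPartialHomeomorph X (Fin n → ℂ)) (m : ℕ), x ∈ φ.source ∧ IsAdapted D φ m := by
  obtain ⟨φ, m, hφ, hx, hm, hcross⟩ := hD x
  obtain ⟨c, hc0, hc⟩ : ∃ c : ℝ, 0 < c ∧ c * ‖φ x‖ < (Real.exp 1)⁻¹ := by
    refine ⟨(Real.exp 1)⁻¹ / (‖φ x‖ + 1), by positivity, ?_⟩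
    rw [div_mul_eq_mul_div, div_lt_iff₀ (by positivity)]
    have : 0 < (Real.exp 1)⁻¹ := by positivity
    nlinarith
  have hcC : (c : ℂ) ≠ 0 := by exact_mod_cast hc0.ne'
  -- Rescaling all coordinates by `c` does not move their zero loci; the restriction to a ball then
  -- gives $|z_i|<1/e$.
  let χ := (φ.transHomeomorph (Homeomorph.smulOfNeZero (c : ℂ) hcC)).trans
    (OpenPartialHomeomorph.ofSet (Metric.ball (0 : Fin n → ℂ) (Real.exp 1)⁻¹) Metric.isOpen_ball)
  have hχ : ∀ y, χ y = (c : ℂ) • φ y := fun y => rfl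
  have hχs : ∀ y, χ.symm y = φ.symm ((c : ℂ)⁻¹ • y) := fun y => rfl
  have hsrc : ∀ y, y ∈ χ.source ↔ y ∈ φ.source ∧ ‖(c : ℂ) • φ y‖ < (Real.exp 1)⁻¹ := by
    intro y
    simp [χ]
  have htgt : ∀ y ∈ χ.target, (c : ℂ)⁻¹ • y ∈ φ.target := by
    intro y hy
    have h1 := χ.map_target hy
    have h2 := χ.right_inv hy
    rw [hχ] at h2
    rw [← h2, smul_smul, inv_mul_cancel₀ hcC, one_smul]
    exact φ.map_source ((hsrc _).1 h1).1
  refine ⟨χ, m, ?_, ?_, ?_, hm, ?_⟩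
  · rw [hsrc, norm_smul, Complex.norm_real, Real.norm_of_nonneg hc0.le]
    exact ⟨hx, hc⟩
  · refine χ.mem_maximalAtlas_of_contMDiffOn ?_ ?_
    · have h1 : ContMDiff 𝓘(ℂ, Fin n → ℂ) 𝓘(ℂ, Fin n → ℂ) ω
          (fun z : Fin n → ℂ => (c : ℂ) • z) :=
        (contDiff_const_smul (c : ℂ)).contMDiff
      exact h1.comp_contMDiffOn ((contMDiffOn_of_mem_maximalAtlas hφ).mono
        fun y hy => ((hsrc y).1 hy).1)
    · have h1 : ContMDiff 𝓘(ℂ, Fin n → ℂ) 𝓘(ℂ, Fin n → ℂ) ω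
          (fun z : Fin n → ℂ => (c : ℂ)⁻¹ • z) :=
        (contDiff_const_smul (c : ℂ)⁻¹).contMDiff
      exact (contMDiffOn_symm_of_mem_maximalAtlas hφ).comp h1.contMDiffOn htgt
  · intro y hy i
    exact (norm_le_pi_norm _ i).trans_lt ((hsrc y).1 hy).2
  · intro y hy
    rw [hcross y ((hsrc y).1 hy).1]
    simp [hχ, hc0.ne']

theorem wedgeConj_I_smul {T : Type*} [SMul ℂ T] {a b : T → ℂ}
    (ha : ∀ v, a (Complex.I • v) = Complex.I * a v) (hb : ∀ v, b (Complex.I • v) = Complex.I * b v)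
    (v : T) : wedgeConj a b v (Complex.I • v) = -2 * Complex.I * (a v * conj (b v)) := by
  unfold wedgeConj
  rw [ha, hb, map_mul, Complex.conj_I]
  ring

theorem dz_I_smul {φ : OpenPartialHomeomorph X (Fin n → ℂ)} (k : Fin n) (x : X)
    (v : TangentSpace 𝓘(ℂ, Fin n → ℂ) x) : dz φ k x (Complex.I • v) = Complex.I * dz φ k x v := by
  unfold dz
  exact map_smul _ _ _

theorem dzeta_I_smul {φ : OpenPartialHomeomorph X (Fin n → ℂ)} (m : ℕ) (k : Fin n) (x : X)
    (v : TangentSpace 𝓘(ℂ, Fin n → ℂ) x) :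
    dzeta φ m k x (Complex.I • v) = Complex.I * dzeta φ m k x v := by
  unfold dzeta
  rw [dz_I_smul]
  split_ifs
  · rw [mul_div_assoc]
  · rfl

/-- The form has a positive minimum on the unit sphere at `p`. Joint continuity and compactness of
the sphere keep half of it nearby, and homogeneity of degree two extends the bound to all vectors.
-/
theorem exists_lower_bound_of_positive {θ : RealTwoForm (Fin n → ℂ) X}
    (hθ : IsSmoothPositiveOneOne θ) {φ : OpenPartialHomeomorph X (Fin n → ℂ)} (hφ : IsHolChart φ)
    {p : X} (hp : p ∈ φ.source) :
    ∃ c : ℝ, 0 < c ∧ ∀ᶠ x in 𝓝 p, ∀ v : TangentSpace 𝓘(ℂ, Fin n → ℂ) x,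
      c * ‖chartVec φ x v‖ ^ 2 ≤
        θ x ![v, Complex.I • v] := by
  obtain ⟨g, hg, hform⟩ := hθ.smooth φ hφ
  let H : X × (Fin n → ℂ) → ℝ := fun q =>
    (∑ j, ∑ k, g j k q.1 * (-2 * Complex.I * (q.2 j * conj (q.2 k)))).re
  have hH : ∀ x ∈ φ.source, ∀ v : TangentSpace 𝓘(ℂ, Fin n → ℂ) x,
      θ x ![v, Complex.I • v] =
        H (x, chartVec φ x v) := by
    intro x hx v
    have h1 := congrArg Complex.re (hform x hx v (Complex.I • v))
    rw [Complex.ofReal_re] at h1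
    rw [h1]
    simp only [H]
    congr 1
    refine Finset.sum_congr rfl fun j _ => Finset.sum_congr rfl fun k _ => ?_
    rw [wedgeConj_I_smul (dz_I_smul j x) (dz_I_smul k x), dz_apply hφ hx, dz_apply hφ hx]
  have hcont : ∀ w, ContinuousAt H (p, w) := by
    intro w
    refine Complex.continuous_re.continuousAt.comp ?_
    refine tendsto_finsetSum _ fun j _ => tendsto_finsetSum _ fun k _ => ?_
    have h1 : ContinuousAt (g j k) p :=
      (hg j k).continuousOn.continuousAt (φ.open_source.mem_nhds hp)
    have h2 : ContinuousAt (fun q : X × (Fin n → ℂ) => g j k q.1) (p, w) :=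
      ContinuousAt.comp (f := Prod.fst) (x := (p, w)) h1 continuousAt_fst
    have h3 : Continuous fun q : X × (Fin n → ℂ) =>
        -2 * Complex.I * (q.2 j * conj (q.2 k)) := by fun_prop
    exact h2.mul h3.continuousAt
  have hpos : ∀ w ∈ Metric.sphere (0 : Fin n → ℂ) 1, 0 < H (p, w) := by
    intro w hw
    obtain ⟨v, rfl⟩ := chartVec_surjective hφ hp w
    have := hθ.positive p v (by
      rintro rfl
      rw [chartVec_zero] at hw
      have h0 : ‖(0 : Fin n → ℂ)‖ = 1 := mem_sphere_zero_iff_norm.1 hw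
      simp at h0)
    rwa [hH p hp v] at this
  have hcS := isCompact_sphere (0 : Fin n → ℂ) 1
  obtain ⟨c, hc, hcle⟩ := hcS.exists_forall_le' (f := fun w => H (p, w))
    (fun w _ => (ContinuousAt.comp (f := fun w => (p, w)) (hcont w)
      (by fun_prop)).continuousWithinAt) hpos
  have hev := hcS.eventually_forall_of_forall_eventually (x₀ := p)
    (P := fun x w => c / 2 < H (x, w)) (fun w hw => by
      exact (hcont w).eventually_const_lt (lt_of_lt_of_le (by linarith) (hcle w hw)))
  refine ⟨c / 2, by linarith, ?_⟩
  filter_upwards [hev, φ.open_source.mem_nhds hp] with x hx hxs v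
  rw [hH x hxs v]
  generalize chartVec φ x v = w
  by_cases hw : w = 0
  · subst hw; simp [H]
  have hw0 : ‖w‖ ≠ 0 := norm_ne_zero_iff.2 hw
  have hsc : H (x, w) = ‖w‖ ^ 2 * H (x, ((‖w‖⁻¹ : ℝ) : ℂ) • w) := by
    simp only [H]
    rw [← Complex.re_ofReal_mul, Finset.mul_sum]
    congr 1
    refine Finset.sum_congr rfl fun j _ => ?_
    rw [Finset.mul_sum]
    refine Finset.sum_congr rfl fun k _ => ?_
    have : (‖w‖ : ℂ) ≠ 0 := by exact_mod_cast hw0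
    simp only [Pi.smul_apply, smul_eq_mul, map_mul, Complex.conj_ofReal]
    push_cast
    field_simp
  rw [hsc, mul_comm]
  gcongr
  refine (hx _ ?_).le
  rw [mem_sphere_zero_iff_norm, norm_smul, Complex.norm_real, norm_inv, norm_norm,
    inv_mul_cancel₀ hw0]

/-- The factor 2 comes from $(a\wedge\bar b)(v,iv)=-2i\,a(v)\overline{b(v)}$, the factor `n` from
Cauchy-Schwarz. -/
theorem abs_le_of_coeff_bound {φ : OpenPartialHomeomorph X (Fin n → ℂ)} (hφ : IsHolChart φ)
    {η : RealTwoForm (Fin n → ℂ) X} {m : ℕ} {α : Fin n → Fin n → X → ℂ} {x : X}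
    (hx : x ∈ φ.source) (hη : ∀ v w : TangentSpace 𝓘(ℂ, Fin n → ℂ) x, (η x ![v, w] : ℂ) =
      ∑ j, ∑ k, α j k x * wedgeConj (dzeta φ m j x) (dzeta φ m k x) v w)
    {G : ℝ} (hG : ∀ j k, ‖α j k x‖ ≤ G) (v : TangentSpace 𝓘(ℂ, Fin n → ℂ) x) :
    |η x ![v, Complex.I • v]| ≤ 2 * n * G * ∑ i, ‖zetaModel m (φ x)
      (chartVec φ x v) i‖ ^ 2 := by
  rw [← Real.norm_eq_abs, ← Complex.norm_real, hη]
  simp only [wedgeConj_I_smul (dzeta_I_smul m _ x) (dzeta_I_smul m _ x), dzeta_apply hφ hx]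
  generalize chartVec φ x v = w
  set ζ := zetaModel m (φ x) w
  rcases n.eq_zero_or_pos with rfl | hn
  · simp
  have hG0 : 0 ≤ G := (norm_nonneg _).trans (hG ⟨0, hn⟩ ⟨0, hn⟩)
  calc ‖∑ j, ∑ k, α j k x * (-2 * Complex.I * (ζ j * conj (ζ k)))‖
      ≤ ∑ j, ∑ k, G * (2 * (‖ζ j‖ * ‖ζ k‖)) := by
        refine (norm_sum_le _ _).trans (Finset.sum_le_sum fun j _ =>
          (norm_sum_le _ _).trans (Finset.sum_le_sum fun k _ => ?_))
        rw [norm_mul]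
        refine mul_le_mul (hG j k) (le_of_eq ?_) (norm_nonneg _) hG0
        simp
    _ = 2 * G * (∑ j, ‖ζ j‖) ^ 2 := by
        rw [sq, Finset.sum_mul_sum, Finset.mul_sum]
        refine Finset.sum_congr rfl fun j _ => ?_
        rw [Finset.mul_sum]
        refine Finset.sum_congr rfl fun k _ => ?_
        ring
    _ ≤ 2 * G * (n * ∑ j, ‖ζ j‖ ^ 2) := by
        gcongr
        simpa using sq_sum_le_card_mul_sum_sq (s := Finset.univ) (f := fun j => ‖ζ j‖)
    _ = _ := by ring

end AdaptedCharts

/-! ### Local expression of a section and of its norm -/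

section LineBundle

variable {E : Type*} [NormedAddCommGroup E] [NormedSpace ℂ E]
  {X : Type*} [TopologicalSpace X] [ChartedSpace E X] [IsManifold 𝓘(ℂ, E) ω X]
  {L : X → Type*} [TopologicalSpace (TotalSpace ℂ L)] [∀ x, AddCommGroup (L x)]
  [∀ x, Module ℂ (L x)] [∀ x, TopologicalSpace (L x)] [FiberBundle ℂ L] [VectorBundle ℂ ℂ L]

/-- In a trivialization at `p`, `F` is the coordinate of `s` and `r` is the logarithm of the squared
norm of the frame; multiplicity one becomes $dF\ne0$ at a zero. -/
theorem exists_local_expression {s : ∀ x, L x} {Z : Set X} (hs : HasDivisor (E := E) L s Z)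
    (h : HermitianMetric E L) {φ : OpenPartialHomeomorph X E}
    (hφ : φ ∈ IsManifold.maximalAtlas 𝓘(ℂ, E) ω X) {p : X} (hp : p ∈ φ.source) :
    ∃ (F : E → ℂ) (r : E → ℝ), AnalyticAt ℂ F (φ p) ∧ ContDiffAt ℝ 2 r (φ p) ∧
      (F (φ p) = 0 → fderiv ℂ F (φ p) ≠ 0) ∧
      ∀ᶠ z in 𝓝 (φ p), (F z = 0 ↔ φ.symm z ∈ Z) ∧
        (F z ≠ 0 →
          Real.log ((h.norm (φ.symm z) (s (φ.symm z)) ^ 2)⁻¹) = logInvSq F r z) := by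
  set e := trivializationAt ℂ L p with he
  set f : X → ℂ := fun y => (e (⟨y, s y⟩ : TotalSpace ℂ L)).2 with hf
  set ρ : X → ℝ := fun y => h.norm y (e.symm y 1) ^ 2 with hρ
  have hpe : p ∈ e.baseSet := mem_baseSet_trivializationAt ℂ L p
  have hbase : e.baseSet ∈ 𝓝 p := e.open_baseSet.mem_nhds hpe
  have hsf : ∀ y ∈ e.baseSet, s y = f y • e.symm y 1 := by
    intro y hy
    have h1 := e.symm_apply_apply_mk hy (s y)
    have h2 := (e.symmₗ ℂ y).map_smul (f y) 1
    rw [smul_eq_mul, mul_one, e.coe_symmₗ hy] at h2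
    exact h1.symm.trans h2
  have hframe : ∀ y ∈ e.baseSet, e.symm y 1 ≠ 0 := by
    intro y hy h0
    have h1 := e.apply_mk_symm hy (1 : ℂ)
    have h2 := (e.continuousLinearEquivAt ℂ y hy).map_zero
    rw [h0] at h1
    have h3 : (e (⟨y, 0⟩ : TotalSpace ℂ L)).2 = 0 := h2
    rw [h1] at h3
    exact one_ne_zero h3
  have hρ0 : ∀ y ∈ e.baseSet, 0 < ρ y := fun y hy => pow_pos (h.norm_pos y _ (hframe y hy)) 2
  have hfp : ContMDiffAt 𝓘(ℂ, E) 𝓘(ℂ, ℂ) ω f p := (contMDiffAt_section p).1 (hs.holomorphic p)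
  have hsymm := contMDiffAt_symm_of_mem_maximalAtlas hφ (φ.map_source hp)
  have hF : ContDiffAt ℂ ω (f ∘ φ.symm) (φ p) := by
    rw [← contMDiffAt_iff_contDiffAt]
    refine ContMDiffAt.comp (I' := 𝓘(ℂ, E)) _ ?_ hsymm
    rwa [φ.left_inv hp]
  have hρs : ContDiffAt ℝ 2 (ρ ∘ φ.symm) (φ p) :=
    contDiffAt_comp_symm_of_smoothOn (h.smooth e) hφ hp hbase
  have hp' : φ.symm (φ p) = p := φ.left_inv hp
  refine ⟨f ∘ φ.symm, fun z => Real.log (ρ (φ.symm z)), hF.analyticAt, ?_, ?_, ?_⟩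
  · refine ContDiffAt.log hρs ?_
    rw [hp']
    exact (hρ0 p hpe).ne'
  · intro hF0 hd
    rw [Function.comp_apply, hp'] at hF0
    have hpZ : p ∈ Z := by
      rw [← hs.zero_iff p, hsf p hpe, hF0, zero_smul]
    refine hs.simple p hpZ ?_
    have h1 : HasMFDerivAt 𝓘(ℂ, E) 𝓘(ℂ, ℂ) (f ∘ φ.symm) (φ p) (0 : E →L[ℂ] ℂ) := by
      have := (hF.differentiableAt (by simp)).hasFDerivAt
      rw [hd] at this
      exact this.hasMFDerivAt
    have h2 := ((contMDiffAt_of_mem_maximalAtlas hφ hp).mdifferentiableAt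
      (by simp)).hasMFDerivAt
    have h3 := h1.comp p h2
    have h4 : f =ᶠ[𝓝 p] (f ∘ φ.symm) ∘ φ := by
      filter_upwards [φ.open_source.mem_nhds hp] with y hy
      simp only [Function.comp_apply]
      rw [φ.left_inv hy]
    have h5 := (h3.congr_of_eventuallyEq h4).mfderiv
    refine h5.trans ?_
    ext v
    rfl
  · have hc : ContinuousAt φ.symm (φ p) := φ.continuousAt_symm (φ.map_source hp)
    have hb : e.baseSet ∈ 𝓝 (φ.symm (φ p)) := by rwa [hp']
    filter_upwards [hc hb] with z hz
    have hz' : φ.symm z ∈ e.baseSet := hz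
    refine ⟨?_, fun hne => ?_⟩
    · rw [← hs.zero_iff, hsf _ hz', smul_eq_zero, or_iff_left (hframe _ hz')]
      rfl
    · have hn0 : ‖f (φ.symm z)‖ ≠ 0 := norm_ne_zero_iff.2 hne
      have : h.norm (φ.symm z) (s (φ.symm z)) ^ 2 = ‖f (φ.symm z)‖ ^ 2 * ρ (φ.symm z) := by
        rw [hsf _ hz', h.norm_smul, mul_pow]
      rw [this, Real.log_inv, Real.log_mul (pow_ne_zero 2 hn0) (hρ0 _ hz').ne', Real.log_pow]
      simp only [logInvSq, Function.comp_apply]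
      push_cast
      ring

end LineBundle

/-! ### Properties of $\Theta_N$, local bounds and globalization -/

section Theta

variable {n : ℕ} {X : Type*} [TopologicalSpace X] [ChartedSpace (Fin n → ℂ) X]
  {ι : Type*} {L : ι → X → Type*} [∀ k, TopologicalSpace (TotalSpace ℂ (L k))]
  [∀ k x, AddCommGroup (L k x)] [∀ k x, Module ℂ (L k x)] [∀ k x, TopologicalSpace (L k x)]
  [∀ k, FiberBundle ℂ (L k)] {D : ι → Set X} {s : ∀ k x, L k x}
  {h : ∀ k, HermitianMetric (Fin n → ℂ) (L k)}

theorem exp_one_le_log_inv_norm_sq (hs : ∀ k, HasDivisor (E := Fin n → ℂ) (L k) (s k) (D k))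
    (hle : ∀ k x, (h k).norm x (s k x) ^ 2 ≤ Real.exp (-Real.exp 1)) {x : X}
    (hx : x ∉ ⋃ k, D k) (k : ι) : Real.exp 1 ≤ Real.log (((h k).norm x (s k x) ^ 2)⁻¹) := by
  have hne : s k x ≠ 0 := fun h0 => hx (mem_iUnion.2 ⟨k, ((hs k).zero_iff x).1 h0⟩)
  have hpos : 0 < (h k).norm x (s k x) ^ 2 := pow_pos ((h k).norm_pos x _ hne) 2
  rw [Real.log_inv, le_neg]
  exact (Real.log_le_iff_le_exp hpos).2 (hle k x)

/-- This is the purpose of the normalization $\|s_k\|_k^2\le e^{-e}$: $\Theta_N$ is then at least 1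
and nondecreasing in $N$. -/
theorem one_le_log_log (hs : ∀ k, HasDivisor (E := Fin n → ℂ) (L k) (s k) (D k))
    (hle : ∀ k x, (h k).norm x (s k x) ^ 2 ≤ Real.exp (-Real.exp 1)) {x : X}
    (hx : x ∉ ⋃ k, D k) (k : ι) :
    1 ≤ Real.log (Real.log (((h k).norm x (s k x) ^ 2)⁻¹)) :=
  one_le_log_of_exp_le (exp_one_le_log_inv_norm_sq hs hle hx k)

variable [Fintype ι]

theorem one_le_Theta [Nonempty ι] (hs : ∀ k, HasDivisor (E := Fin n → ℂ) (L k) (s k) (D k))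
    (hle : ∀ k x, (h k).norm x (s k x) ^ 2 ≤ Real.exp (-Real.exp 1)) {x : X}
    (hx : x ∉ ⋃ k, D k) (N : ℕ) : 1 ≤ Theta h s N x := by
  obtain ⟨k⟩ := ‹Nonempty ι›
  have h1 := fun k => one_le_pow₀ (n := N) (one_le_log_log hs hle hx k)
  exact (h1 k).trans (Finset.single_le_sum
    (f := fun k => Real.log (Real.log ((h k).norm x (s k x) ^ 2)⁻¹) ^ N)
    (fun j _ => zero_le_one.trans (h1 j)) (Finset.mem_univ k))

theorem Theta_mono (hs : ∀ k, HasDivisor (E := Fin n → ℂ) (L k) (s k) (D k))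
    (hle : ∀ k x, (h k).norm x (s k x) ^ 2 ≤ Real.exp (-Real.exp 1)) {x : X}
    (hx : x ∉ ⋃ k, D k) {N N' : ℕ} (hN : N ≤ N') : Theta h s N x ≤ Theta h s N' x :=
  Finset.sum_le_sum fun k _ => pow_le_pow_right₀ (one_le_log_log hs hle hx k) hN

/-- The power mean inequality for the nonnegative numbers $\log\log\|s_k\|_k^{-2}$. -/
theorem Theta_one_pow_le (hs : ∀ k, HasDivisor (E := Fin n → ℂ) (L k) (s k) (D k))
    (hle : ∀ k x, (h k).norm x (s k x) ^ 2 ≤ Real.exp (-Real.exp 1)) {x : X}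
    (hx : x ∉ ⋃ k, D k) (N : ℕ) :
    Theta h s 1 x ^ (N + 1) ≤ (Fintype.card ι : ℝ) ^ N * Theta h s (N + 1) x := by
  rcases isEmpty_or_nonempty ι with hι | hι
  · simp [Theta]
  have := pow_sum_div_card_le_sum_pow (s := (Finset.univ : Finset ι))
    (f := fun k => Real.log (Real.log ((h k).norm x (s k x) ^ 2)⁻¹))
    (fun k _ => zero_le_one.trans (one_le_log_log hs hle hx k)) N
  rw [div_le_iff₀ (by simp [Fintype.card_pos])] at this
  simpa [Theta, mul_comm] using this

/-- The conclusion of the theorem at the point `x`, together with the positivity of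
`dd^c (-Θ_1) + A θ`. -/
def BoundAt (h : ∀ k, HermitianMetric (Fin n → ℂ) (L k)) (s : ∀ k x, L k x)
    (θ η : RealTwoForm (Fin n → ℂ) X) (A B : ℝ) (N : ℕ) (x : X) : Prop :=
  ∀ v : TangentSpace 𝓘(ℂ, Fin n → ℂ) x,
    0 ≤ ddc (fun y => -Theta h s 1 y) x ![v, Complex.I • v] + A * θ x ![v, Complex.I • v] ∧
    0 ≤ η x ![v, Complex.I • v] + B * Theta h s N x *
      (ddc (fun y => -Theta h s 1 y) x ![v, Complex.I • v] + A * θ x ![v, Complex.I • v])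

/-- Raising `A` adds a nonnegative form. Raising `B` or `N` enlarges the factor of
$dd^c(-\Theta_1)+A\theta$, which helps only because `BoundAt` also records that this form is
nonnegative. -/
theorem BoundAt.mono [Nonempty ι] (hs : ∀ k, HasDivisor (E := Fin n → ℂ) (L k) (s k) (D k))
    (hle : ∀ k x, (h k).norm x (s k x) ^ 2 ≤ Real.exp (-Real.exp 1))
    {θ η : RealTwoForm (Fin n → ℂ) X} (hθ : ∀ x, NonnegAt θ x) {x : X} (hx : x ∉ ⋃ k, D k)
    {A A' B B' : ℝ} {N N' : ℕ} (hB : 0 ≤ B) (hA : A ≤ A') (hBB : B ≤ B') (hN : N ≤ N')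
    (hb : BoundAt h s θ η A B N x) : BoundAt h s θ η A' B' N' x := by
  intro v
  obtain ⟨h1, h2⟩ := hb v
  have hθv := hθ x v
  set d := ddc (fun y => -Theta h s 1 y) x ![v, Complex.I • v]
  have hAA : d + A * θ x ![v, Complex.I • v] ≤ d + A' * θ x ![v, Complex.I • v] := by gcongr
  have hΘ := one_le_Theta (h := h) hs hle hx N
  have hΘ' := Theta_mono (h := h) hs hle hx hN
  refine ⟨h1.trans hAA, h2.trans ?_⟩
  have h3 : B * Theta h s N x ≤ B' * Theta h s N' x := by gcongr; linarith
  have h4 : 0 ≤ B' * Theta h s N' x := (mul_nonneg hB (by linarith)).trans h3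
  have := mul_le_mul h3 hAA h1 h4
  linarith

theorem BoundAt.nonnegAt {θ η : RealTwoForm (Fin n → ℂ) X} {A B : ℝ} {N : ℕ} {x : X}
    (hb : BoundAt h s θ η A B N x) : NonnegAt (boundForm h s θ η A B N) x :=
  fun v => (hb v).2

/-- Finitely many neighbourhoods cover `X`, and the maxima of their constants work. The set `S` of
allowed exponents lets one argument treat both claims: `S = univ` in general, `S = {0}` for Poincaré
growth. -/
theorem exists_global_boundAt [CompactSpace X] [Nonempty ι]
    (hs : ∀ k, HasDivisor (E := Fin n → ℂ) (L k) (s k) (D k))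
    (hle : ∀ k x, (h k).norm x (s k x) ^ 2 ≤ Real.exp (-Real.exp 1))
    {θ η : RealTwoForm (Fin n → ℂ) X} (hθ : ∀ x, NonnegAt θ x) {S : Set ℕ}
    (hS : ∀ N ∈ S, ∀ N' ∈ S, max N N' ∈ S) (hS' : S.Nonempty)
    (hloc : ∀ p : X, ∃ N ∈ S, ∃ A B : ℝ, 0 < A ∧ 0 < B ∧
      ∀ᶠ x in 𝓝 p, x ∉ ⋃ k, D k → BoundAt h s θ η A B N x) :
    ∃ N ∈ S, ∃ A B : ℝ, 0 < A ∧ 0 < B ∧ ∀ x ∉ ⋃ k, D k, BoundAt h s θ η A B N x := by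
  have := isCompact_univ (X := X) |>.induction_on
    (p := fun V => ∃ N ∈ S, ∃ A B : ℝ, 0 < A ∧ 0 < B ∧
      ∀ x ∈ V, x ∉ ⋃ k, D k → BoundAt h s θ η A B N x)
    (by obtain ⟨N, hN⟩ := hS'; exact ⟨N, hN, 1, 1, one_pos, one_pos, by simp⟩)
    (fun V W hVW ⟨N, hN, A, B, hA, hB, hb⟩ => ⟨N, hN, A, B, hA, hB, fun x hx => hb x (hVW hx)⟩)
    (fun V W ⟨N, hN, A, B, hA, hB, hb⟩ ⟨N', hN', A', B', hA', hB', hb'⟩ =>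
      ⟨max N N', hS N hN N' hN', max A A', max B B', hA.trans_le (le_max_left _ _),
        hB.trans_le (le_max_left _ _), fun x hx hxD => hx.elim
          (fun hx => (hb x hx hxD).mono hs hle hθ hxD hB.le (le_max_left _ _) (le_max_left _ _)
            (le_max_left _ _))
          (fun hx => (hb' x hx hxD).mono hs hle hθ hxD hB'.le (le_max_right _ _)
            (le_max_right _ _) (le_max_right _ _))⟩)
    (fun p _ => by
      obtain ⟨N, hN, A, B, hA, hB, hb⟩ := hloc p
      exact ⟨_, mem_nhdsWithin_of_mem_nhds hb, N, hN, A, B, hA, hB, fun x hx => hx⟩)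
  simpa using this

variable [IsManifold 𝓘(ℂ, Fin n → ℂ) ω X] [∀ k, VectorBundle ℂ ℂ (L k)]

theorem ddc_Theta_lower_bound [Nonempty ι]
    (hs : ∀ k, HasDivisor (E := Fin n → ℂ) (L k) (s k) (D k))
    (hle : ∀ k x, (h k).norm x (s k x) ^ 2 ≤ Real.exp (-Real.exp 1))
    {φ : OpenPartialHomeomorph X (Fin n → ℂ)} {m : ℕ} (hφ : IsAdapted (⋃ k, D k) φ m) {p : X}
    (hp : p ∈ φ.source) :
    ∃ C : ℝ, 0 < C ∧ ∀ᶠ x in 𝓝 p, x ∉ ⋃ k, D k →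
      (∀ i : Fin n, i.val < m → Real.log (Real.log ‖φ x i‖⁻¹) ≤ C * Theta h s 1 x) ∧
      ∀ v : TangentSpace 𝓘(ℂ, Fin n → ℂ) x, ∑ i, ‖zetaModel m (φ x) (chartVec φ x v) i‖ ^ 2 ≤
        C * (4 * Real.pi * ddc (fun y => -Theta h s 1 y) x ![v, Complex.I • v] +
          C * ‖chartVec φ x v‖ ^ 2) := by
  choose F r hF hr hd hev using fun k =>
    exists_local_expression (hs k) (h k) hφ.holomorphic hp
  have hall := eventually_all.2 hev
  have htgt : ∀ᶠ z in 𝓝 (φ p), z ∈ φ.target := φ.open_target.mem_nhds (φ.map_source hp)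
  have hzero : ∀ᶠ z in 𝓝 (φ p), (∃ k, F k z = 0) ↔ ∃ i : Fin n, i.val < m ∧ z i = 0 := by
    filter_upwards [hall, htgt] with z hz hzt
    have h1 := hφ.crossing.2 (φ.symm z) (φ.map_target hzt)
    rw [φ.right_inv hzt, mem_iUnion] at h1
    rw [← h1]
    exact exists_congr fun k => (hz k).1
  obtain ⟨C, hC, hmain⟩ := local_poincare_bound (hφ.small p hp) hF hr hzero hd
  have hFc : ∀ᶠ z in 𝓝 (φ p), ∀ k, ContinuousAt (F k) z := eventually_all.2 fun k =>
    (hF k).eventually_analyticAt.mono fun _ hz => hz.continuousAt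
  refine ⟨C, hC, ?_⟩
  filter_upwards [(φ.continuousAt hp).eventually
      (hmain.and (hFc.and (eventually_eventually_nhds.2 hall))),
    φ.open_source.mem_nhds hp] with x ⟨h1, h2, h3⟩ hxs hxD
  have h3x := h3.self_of_nhds
  have hne : ∀ k, F k (φ x) ≠ 0 := by
    intro k h0
    have := (h3x k).1.1 h0
    rw [φ.left_inv hxs] at this
    exact hxD (mem_iUnion.2 ⟨k, this⟩)
  have hlog : ∀ k, Real.log (((h k).norm x (s k x) ^ 2)⁻¹) = logInvSq (F k) (r k) (φ x) := by
    intro k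
    have := (h3x k).2 (hne k)
    rwa [φ.left_inv hxs] at this
  have hU : ∀ k, Real.exp 1 ≤ logInvSq (F k) (r k) (φ x) := fun k => by
    rw [← hlog k]; exact exp_one_le_log_inv_norm_sq hs hle hxD k
  obtain ⟨hlog_le, hsmooth, hζ⟩ := h1 hne hU
  have hTh : Theta h s 1 x = ∑ k, Real.log (logInvSq (F k) (r k) (φ x)) := by
    simp only [Theta, pow_one, hlog]
  -- Second derivatives need equality of germs at $\varphi(x)$, not only of values; hence
  -- `eventually_eventually_nhds` above.
  have heq : (fun y => -Theta h s 1 y) ∘ φ.symm =ᶠ[𝓝 (φ x)]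
      fun z => ∑ k, -Real.log (logInvSq (F k) (r k) z) := by
    have hne' : ∀ᶠ z in 𝓝 (φ x), ∀ k, F k z ≠ 0 :=
      eventually_all.2 fun k => (h2 k).eventually_ne (hne k)
    filter_upwards [hne', h3] with z hz1 hz2
    simp only [Function.comp_apply, Theta, pow_one, Finset.sum_neg_distrib]
    congr 1
    exact Finset.sum_congr rfl fun k _ => by rw [(hz2 k).2 (hz1 k)]
  refine ⟨fun i hi => ?_, fun v => ?_⟩
  · rw [hTh]; exact hlog_le i hi
  · rw [ddc_eq_levi_chart hφ.holomorphic hxs (hsmooth.congr_of_eventuallyEq heq),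
      levi_congr heq]
    refine (hζ _).trans (le_of_eq ?_)
    have := Real.pi_pos.ne'
    field_simp

theorem exists_local_boundAt [Nonempty ι]
    (hs : ∀ k, HasDivisor (E := Fin n → ℂ) (L k) (s k) (D k))
    (hle : ∀ k x, (h k).norm x (s k x) ^ 2 ≤ Real.exp (-Real.exp 1))
    {θ η : RealTwoForm (Fin n → ℂ) X} (hθ : IsSmoothPositiveOneOne θ)
    {φ : OpenPartialHomeomorph X (Fin n → ℂ)} {m : ℕ} (hφ : IsAdapted (⋃ k, D k) φ m) {p : X}
    (hp : p ∈ φ.source) {α : Fin n → Fin n → X → ℂ}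
    (hη : ∀ x ∈ φ.source \ ⋃ k, D k, ∀ v w : TangentSpace 𝓘(ℂ, Fin n → ℂ) x,
      (η x ![v, w] : ℂ) =
        ∑ j, ∑ k, α j k x * wedgeConj (dzeta φ m j x) (dzeta φ m k x) v w) {N : ℕ}
    (hα : ∀ j k, ∃ G : ℝ, 0 < G ∧ ∀ᶠ x in 𝓝 p, x ∉ ⋃ k, D k →
      ‖α j k x‖ ≤ G * Theta h s N x) :
    ∃ A B : ℝ, 0 < A ∧ 0 < B ∧ ∀ᶠ x in 𝓝 p, x ∉ ⋃ k, D k → BoundAt h s θ η A B N x := by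
  obtain ⟨C, hC, hev⟩ := ddc_Theta_lower_bound (h := h) hs hle hφ hp
  obtain ⟨c, hc, hθc⟩ := exists_lower_bound_of_positive hθ hφ.holomorphic hp
  obtain ⟨G, hG, hαG⟩ := exists_uniform_const (ι := Fin n × Fin n) (l := 𝓝 p)
    (P := fun q G x => x ∉ ⋃ k, D k → ‖α q.1 q.2 x‖ ≤ G * Theta h s N x)
    (fun q x G G' hGG hq hx => (hq hx).trans (by
      have := one_le_Theta (h := h) hs hle hx N
      gcongr)) (fun q => hα q.1 q.2)
  have hπ := Real.pi_pos
  -- `A` converts the Euclidean error $C|w|^2$ into $\theta$ through $c|w|^2\le\theta(v,iv)$. `B`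
  -- combines the coefficient bound with the Poincaré comparison; `n + 1` keeps it positive when `n
  -- = 0`.
  refine ⟨C / (4 * Real.pi * c), 2 * (n + 1) * G * (C * (4 * Real.pi)), by positivity,
    by positivity, ?_⟩
  filter_upwards [hev, hθc, hαG, φ.open_source.mem_nhds hp] with x h1 h2 h3 hxs hxD v
  have hη' := abs_le_of_coeff_bound hφ.holomorphic hxs (hη x ⟨hxs, hxD⟩)
    (fun j k => h3 (j, k) hxD) v
  have h4 := (h1 hxD).2 v
  have h5 := h2 v
  set Z := ∑ i, ‖zetaModel m (φ x) (chartVec φ x v) i‖ ^ 2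
  have hZ : 0 ≤ Z := Finset.sum_nonneg fun i _ => by positivity
  set d := ddc (fun y => -Theta h s 1 y) x ![v, Complex.I • v]
  set t := θ x ![v, Complex.I • v]
  have hΘ := one_le_Theta (h := h) hs hle hxD N
  set T := Theta h s N x
  have h6 : Z ≤ C * (4 * Real.pi) * (d + C / (4 * Real.pi * c) * t) := by
    have : C * ‖chartVec φ x v‖ ^ 2 ≤ C * (t / c) := by
      gcongr
      rw [le_div_iff₀ hc]
      linarith
    calc Z ≤ C * (4 * Real.pi * d + C * ‖chartVec φ x v‖ ^ 2) := h4
      _ ≤ C * (4 * Real.pi * d + C * (t / c)) := by gcongr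
      _ = _ := by field_simp
  refine ⟨nonneg_of_mul_nonneg_right (hZ.trans h6) (by positivity), ?_⟩
  have h7 := (abs_le.1 hη').1
  have h8 : 2 * n * (G * T) * Z ≤ 2 * (n + 1) * G * T *
      (C * (4 * Real.pi) * (d + C / (4 * Real.pi * c) * t)) := by
    refine mul_le_mul ?_ h6 hZ (by positivity)
    have : 0 ≤ G * T := by positivity
    linarith
  linarith

theorem exists_growth_le_Theta [Nonempty ι]
    (hs : ∀ k, HasDivisor (E := Fin n → ℂ) (L k) (s k) (D k))
    (hle : ∀ k x, (h k).norm x (s k x) ^ 2 ≤ Real.exp (-Real.exp 1))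
    {φ : OpenPartialHomeomorph X (Fin n → ℂ)} {m : ℕ} (hφ : IsAdapted (⋃ k, D k) φ m) {p : X}
    (hp : p ∈ φ.source) {V : Set X} (hV : V ∈ 𝓝 p) {f : X → ℂ} {M : ℕ} {K : ℝ}
    (hf : ∀ x ∈ V \ ⋃ k, D k,
      ‖f x‖ ≤ K * ∏ i : Fin n with i.val < m, Real.log (Real.log ‖φ x i‖⁻¹) ^ M) :
    ∃ N, ∃ G : ℝ, 0 < G ∧ ∀ᶠ x in 𝓝 p, x ∉ ⋃ k, D k → ‖f x‖ ≤ G * Theta h s N x := by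
  obtain ⟨C, hC, hev⟩ := ddc_Theta_lower_bound (h := h) hs hle hφ hp
  set q := (Finset.univ.filter fun i : Fin n => i.val < m).card
  -- The product has `q` factors, each at most $((C+1)\Theta_1)^M$. One more power of $\Theta_1\ge1$
  -- puts the exponent in the form required by `Theta_one_pow_le`.
  refine ⟨M * q + 1, (|K| + 1) * (C + 1) ^ (M * q) * (Fintype.card ι : ℝ) ^ (M * q), ?_, ?_⟩
  · have : (0 : ℝ) < Fintype.card ι := by exact_mod_cast Fintype.card_pos
    positivity
  filter_upwards [hev, hV, φ.open_source.mem_nhds hp] with x h1 hxV hxs hxD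
  have hΘ := one_le_Theta (h := h) hs hle hxD 1
  have hl : ∀ i : Fin n, i.val < m → 0 ≤ Real.log (Real.log ‖φ x i‖⁻¹) := by
    intro i hi
    have hne : φ x i ≠ 0 := fun h0 => hxD ((hφ.crossing.2 x hxs).2 ⟨i, hi, h0⟩)
    exact Real.log_nonneg (one_lt_log_inv (norm_pos_iff.2 hne) (hφ.small x hxs i)).le
  have hprod : ∏ i : Fin n with i.val < m, Real.log (Real.log ‖φ x i‖⁻¹) ^ M ≤
      ((C + 1) * Theta h s 1 x) ^ (M * q) := by
    rw [pow_mul, ← Finset.prod_const]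
    refine Finset.prod_le_prod (fun i hi => pow_nonneg (hl i (Finset.mem_filter.1 hi).2) _)
      fun i hi => ?_
    have hi' := (Finset.mem_filter.1 hi).2
    refine pow_le_pow_left₀ (hl i hi') (((h1 hxD).1 i hi').trans ?_) M
    gcongr
    linarith
  have hprod0 : 0 ≤ ∏ i : Fin n with i.val < m, Real.log (Real.log ‖φ x i‖⁻¹) ^ M :=
    Finset.prod_nonneg fun i hi => pow_nonneg (hl i (Finset.mem_filter.1 hi).2) _
  have h2 : Theta h s 1 x ^ (M * q) ≤ Theta h s 1 x ^ (M * q + 1) :=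
    pow_le_pow_right₀ hΘ (Nat.le_succ _)
  calc ‖f x‖ ≤ K * ∏ i : Fin n with i.val < m, Real.log (Real.log ‖φ x i‖⁻¹) ^ M :=
        hf x ⟨hxV, hxD⟩
    _ ≤ (|K| + 1) * ((C + 1) * Theta h s 1 x) ^ (M * q) := by
        refine mul_le_mul (by linarith [le_abs_self K]) hprod hprod0 (by positivity)
    _ = (|K| + 1) * (C + 1) ^ (M * q) * Theta h s 1 x ^ (M * q) := by rw [mul_pow]; ring
    _ ≤ (|K| + 1) * (C + 1) ^ (M * q) *
          ((Fintype.card ι : ℝ) ^ (M * q) * Theta h s (M * q + 1) x) := by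
        gcongr
        exact h2.trans (Theta_one_pow_le hs hle hxD _)
    _ = _ := by ring

end Theta

end LogLogForms

end

/-! ### The theorem -/

open LogLogForms in
theorem theorem4p1 {n : ℕ} {X : Type*} [TopologicalSpace X] [T2Space X] [CompactSpace X]
    [ChartedSpace (Fin n → ℂ) X] [IsManifold 𝓘(ℂ, Fin n → ℂ) ω X]
    {ι : Type*} [Fintype ι] [Nonempty ι] (D : ι → Set X) (hD : IsSNC (n := n) D)
    (L : ι → X → Type*) [∀ k, TopologicalSpace (TotalSpace ℂ (L k))]
    [∀ k x, AddCommGroup (L k x)] [∀ k x, Module ℂ (L k x)] [∀ k x, TopologicalSpace (L k x)]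
    [∀ k, FiberBundle ℂ (L k)] [∀ k, VectorBundle ℂ ℂ (L k)]
    [∀ k, ContMDiffVectorBundle ω ℂ (L k) 𝓘(ℂ, Fin n → ℂ)]
    (s : ∀ k x, L k x) (hs : ∀ k, HasDivisor (E := Fin n → ℂ) (L k) (s k) (D k))
    (h : ∀ k, HermitianMetric (Fin n → ℂ) (L k))
    (hle : ∀ k x, (h k).norm x (s k x) ^ 2 ≤ Real.exp (-Real.exp 1))
    (Om : RealTwoForm (Fin n → ℂ) X) (hOm : IsSmoothPositiveOneOne Om)
    (η : RealTwoForm (Fin n → ℂ) X) (hη : IsLogLogGrowthOneOne (⋃ k, D k) η) :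
    (∃ A B : ℝ, ∃ N : ℕ, 0 < A ∧ 0 < B ∧
        ∀ x ∉ ⋃ k, D k, NonnegAt (boundForm h s Om η A B N) x) ∧
      (IsPoincareGrowthOneOne (⋃ k, D k) η → ∃ A B : ℝ, 0 < A ∧ 0 < B ∧
        ∀ x ∉ ⋃ k, D k, NonnegAt (boundForm h s Om η A B 0) x) := by
  have hOm0 : ∀ x, NonnegAt Om x := fun x v => by
    by_cases hv : v = 0
    · have h0 : Om x ![v, Complex.I • v] = 0 :=
        (Om x).toMultilinearMap.map_coord_zero (0 : Fin 2) hv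
      exact h0.ge
    · exact (hOm.positive x v hv).le
  -- The growth conditions bound coefficients only on relatively compact open subsets of a chart;
  -- regularity of `X` supplies one around each point.
  have hnhds : ∀ (p : X) (U : Set X), U ∈ nhds p →
      ∃ V, V ∈ nhds p ∧ IsOpen V ∧ IsCompact (closure V) ∧ closure V ⊆ U := fun p U hU => by
    obtain ⟨K, hK, hKc, hKU⟩ := exists_mem_nhds_isClosed_subset hU
    exact ⟨interior K, interior_mem_nhds.2 hK, isOpen_interior, isClosed_closure.isCompact,
      (closure_minimal interior_subset hKc).trans hKU⟩
  refine ⟨?_, fun hη' => ?_⟩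
  · obtain ⟨N, -, A, B, hA, hB, hb⟩ := exists_global_boundAt (S := univ) (η := η) (h := h) hs hle
      hOm0 (fun _ _ _ _ => mem_univ _) univ_nonempty (fun p => by
        obtain ⟨φ, m, hp, hφ⟩ := exists_isAdapted hD.normalCrossings p
        obtain ⟨α, hα, hform⟩ := hη φ m hφ
        obtain ⟨V, hVp, hVo, hVc, hVs⟩ := hnhds p _ (φ.open_source.mem_nhds hp)
        choose M K hMK using fun j k => (hα j k).2 V hVo hVc hVs
        choose N G hG hNG using fun j k =>
          exists_growth_le_Theta (h := h) hs hle hφ hp hVp (hMK j k)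
        -- The sum serves as a common upper bound for the exponents of all the coefficients.
        refine ⟨∑ j, ∑ k, N j k, mem_univ _,
          exists_local_boundAt hs hle hOm hφ hp hform fun j k => ⟨G j k, hG j k, ?_⟩⟩
        filter_upwards [hNG j k] with x hx hxD
        refine (hx hxD).trans (mul_le_mul_of_nonneg_left (Theta_mono hs hle hxD ?_) (hG j k).le)
        exact (Finset.single_le_sum (f := fun k => N j k) (fun _ _ => Nat.zero_le _)
          (Finset.mem_univ k)).trans (Finset.single_le_sum (f := fun j => ∑ k, N j k)
          (fun _ _ => Nat.zero_le _) (Finset.mem_univ j)))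
    exact ⟨A, B, N, hA, hB, fun x hx => (hb x hx).nonnegAt⟩
  · obtain ⟨N, hN, A, B, hA, hB, hb⟩ := exists_global_boundAt (S := {0}) (η := η) (h := h) hs hle
      hOm0 (by simp) (singleton_nonempty 0) (fun p => by
        obtain ⟨φ, m, hp, hφ⟩ := exists_isAdapted hD.normalCrossings p
        obtain ⟨α, hα, hform⟩ := hη' φ m hφ
        obtain ⟨V, hVp, hVo, hVc, hVs⟩ := hnhds p _ (φ.open_source.mem_nhds hp)
        refine ⟨0, rfl, exists_local_boundAt hs hle hOm hφ hp hform fun j k => ?_⟩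
        obtain ⟨K, hK⟩ := (hα j k).2 V hVo hVc hVs
        refine ⟨|K| + 1, by positivity, ?_⟩
        filter_upwards [hVp] with x hx hxD
        calc ‖α j k x‖ ≤ |K| + 1 := (hK x ⟨hx, hxD⟩).trans (by linarith [le_abs_self K])
          _ ≤ (|K| + 1) * Theta h s 0 x :=
            le_mul_of_one_le_right (by positivity) (one_le_Theta hs hle hxD 0))
    obtain rfl : N = 0 := hN
    exact ⟨A, B, hA, hB, fun x hx => (hb x hx).nonnegAt⟩
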